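/- Let $\Bbbk$ be a field and $S$ a set. Let $S^*$ be the set of words in $S$ and $\Bbbk\langle S\rangle$ the algebra of noncommutative polynomials. A series is a map $\beta:S^*\to\Bbbk$, extended linearly to $\Bbbk\langle S\rangle$; it is symmetric if $\beta(vw)=\beta(wv)$ for all $v,w\in S^*$. Put $I_\beta=\{u:\beta(vuw)=0\ \forall v,w\}$, $I^{\ell}_\beta=\{u:\beta(vu)=0\ \forall v\}$, $I^{r}_\beta=\{u:\beta(uv)=0\ \forall v\}$, where $u,v,w\in\Bbbk\langle S\rangle$. *Cobordisms.* Let $\mathcal C$ be the category whose objects are finite sequences of signs $\pm$ and whose morphisms are compact oriented one-manifolds with the corresponding boundary, decorated by finitely many $S$-labelled dots, up to diffeomorphism rel boundary. Thus each component is an oriented interval or circle carrying a word in $S$ (up to cyclic rotation for a circle); words are written from right to left along the orientation. Let $\widetilde{\mathcal C}\supset\mathcal C$ be the larger category with the same objects, in which intervals may also have inner (floating) endpoints, that is, endpoints not on the top or bottom boundary. A component is floating if it has no point on the top or bottom boundary. *Skein categories.* For a symmetric series $\alpha^\circ$, the category $\mathcal{SC}_{\alpha^\circ}$ is the quotient of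 the $\Bbbk$-linearization $\Bbbk\mathcal C$ by the relations: a floating circle with word $w$ is removed at the cost of the factor $\alpha^\circ(w)$; and any element of $I_{\alpha^\circ}$ inserted at any place along a component gives $0$. For a series $\alpha^\bullet$ and a symmetric series $\alpha^\circ$, the category $\mathcal S\widetilde{\mathcal C}_{(\alpha^\bullet,\alpha^\circ)}$ is the quotient of $\Bbbk\widetilde{\mathcal C}$ by the relations: floating intervals and circles with word $w$ are removed at the cost of the factors $\alpha^\bullet(w)$ and $\alpha^\circ(w)$, respectively; any element of $I_{\alpha^\bullet}\cap I_{\alpha^\circ}$ inserted at any place along a component gives $0$; any element of $I^{\ell}_{\alpha^\bullet}$ inserted at the very beginning of an interval that starts at an inner endpoint gives $0$; and any element of $I^{r}_{\alpha^\bullet}$ inserted at the very end of an interval that ends at an inner endpoint gives $0$. *Gligible and Deligne categories.* On a skein category the trace of an endomorphism is obtained by closing it up (joining each top point to the corresponding bottom point) and evaluating the floating components multiplicatively. A morphism $y:X\to Y$ is negligible if $\operatorname{tr}(zy)=0$ for all $z:Y\to X$. The gligible categories $\mathcal C_{\alpha^\circ}$, $\widetilde{\mathcal C}_{(\alpha^\bullet,\alpha^\circ)}$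 are the quotients of the skein categories by the ideals of negligible morphisms. The Deligne categories $\mathcal{DC}_{\alpha^\circ}$, $\mathcal D\widetilde{\mathcal C}_{(\alpha^\bullet,\alpha^\circ)}$ are the additive Karoubi closures of the skein categories (formal finite direct sums, then formal images of idempotents), with the trace extended by summing over diagonal entries. The gligible-Deligne categories $\underline{\mathcal{DC}}_{\alpha^\circ}$, $\underline{\mathcal D\widetilde{\mathcal C}}_{(\alpha^\bullet,\alpha^\circ)}$ are the quotients of the Deligne categories by their ideals of negligible morphisms. In both settings these categories form a commutative square of functors: skein $\to$ Deligne $\to$ gligible-Deligne (inclusion, then quotient) equals skein $\to$ gligible $\to$ gligible-Deligne (quotient, then the functor induced by the inclusion). **Theorem.** For every symmetric series $\alpha^\circ$ there are $\Bbbk$-linear equivalences of categories $$\mathcal S\widetilde{\mathcal C}_{(0,\alpha^\circ)}\cong\mathcal{SC}_{\alpha^\circ},\qquad \widetilde{\mathcal C}_{(0,\alpha^\circ)}\cong\mathcal C_{\alpha^\circ},\qquad \mathcal D\widetilde{\mathcal C}_{(0,\alpha^\circ)}\cong\mathcal{DC}_{\alpha^\circ},\qquad \underline{\mathcal D\widetilde{\mathcal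 C}}_{(0,\alpha^\circ)}\cong\underline{\mathcal{DC}}_{\alpha^\circ}$$ such that the composite $\mathcal C\hookrightarrow\widetilde{\mathcal C}\to\mathcal S\widetilde{\mathcal C}_{(0,\alpha^\circ)}\to\mathcal{SC}_{\alpha^\circ}$ is naturally isomorphic to the canonical functor $\mathcal C\to\mathcal{SC}_{\alpha^\circ}$, and which respect the two commutative squares: for each of the four functors of the square, the equivalences at its source and target intertwine the two versions of the functor up to natural isomorphism, and these four natural isomorphisms can be chosen coherently, i.e. the two natural isomorphisms they induce along the two paths of the square from the skein category to the gligible-Deligne category are equal. -/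

import Mathlib

open CategoryTheory

namespace DecCob

universe u v w

/-- A connected component of a decorated oriented one-manifold whose boundary points are named by
elements of `P`. An arc runs from `a` to `b`, where `none` stands for an inner (floating) endpoint;
the word `w` lists the labels of its dots, written from right to left along the orientation.
A circle carries a word up to cyclic rotation. -/
inductive Component (S : Type u) (P : Type) : Type u
  | arc (a : Option P) (w : List S) (b : Option P) : Component S P
  | circle (c : Cycle S) : Component S P

/-- A decorated oriented one-manifold up to diffeomorphism: the finite multiset of its connected
components. -/
abbrev Diagram (S : Type u) (P : Type) : Type u := Multiset (Component S P)

theorem isRotated_flatMap {S : Type u} {T : Type v} (φ : S → List T) {l l' : List S}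
    (h : l.IsRotated l') : (l.flatMap φ).IsRotated (l'.flatMap φ) := by
  obtain ⟨n, hn, rfl⟩ := List.isRotated_iff_mod.1 h
  rw [List.rotate_eq_drop_append_take hn]
  conv_lhs => rw [← List.take_append_drop n l]
  rw [List.flatMap_append, List.flatMap_append]
  exact List.isRotated_append

/-- Apply a substitution of letters by words to a cyclic word. -/
def cycleSubst {S : Type u} {T : Type v} (φ : S → List T) : Cycle S → Cycle T :=
  Quotient.map' (fun l => l.flatMap φ) (fun _ _ h => isRotated_flatMap φ h)

@[simp] theorem cycleSubst_coe {S : Type u} {T : Type v} (φ : S → List T) (l : List S) :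
    cycleSubst φ (l : Cycle S) = ((l.flatMap φ : List T) : Cycle T) := rfl

namespace Component

variable {S : Type u} {T : Type v} {P Q R : Type}

/-- The boundary point at which an arc starts, if it does not start at an inner endpoint. -/
def source : Component S P → Option P
  | arc a _ _ => a
  | circle _ => none

/-- The boundary point at which an arc ends, if it does not end at an inner endpoint. -/
def target : Component S P → Option P
  | arc _ _ b => b
  | circle _ => none

/-- The component is an arc with at least one inner endpoint. -/
def HasInnerEnd : Component S P → Prop
  | arc a _ b => a = none ∨ b = none
  | circle _ => False

/-- Rename the boundary points. -/
def relabel (f : P → Q) : Component S P → Component S Q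
  | arc a w b => arc (a.map f) w (b.map f)
  | circle c => circle c

/-- Replace each dot by a (possibly empty) word of dots. -/
def subst (φ : S → List T) : Component S P → Component T P
  | arc a w b => arc a (w.flatMap φ) b
  | circle c => circle (cycleSubst φ c)

@[simp] theorem hasInnerEnd_relabel (f : P → Q) (c : Component S P) :
    (c.relabel f).HasInnerEnd ↔ c.HasInnerEnd := by
  cases c <;> simp [relabel, HasInnerEnd]

@[simp] theorem hasInnerEnd_subst (φ : S → List T) (c : Component S P) :
    (c.subst φ).HasInnerEnd ↔ c.HasInnerEnd := by
  cases c <;> simp [subst, HasInnerEnd]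

theorem relabel_injective {f : P → Q} (hf : f.Injective) :
    (relabel (S := S) f).Injective := by
  intro c d h
  cases c <;> cases d <;> simp [relabel] at h ⊢
  · exact ⟨Option.map_injective hf h.1, h.2.1, Option.map_injective hf h.2.2⟩
  · exact h

end Component

namespace Diagram

open Component Relation

variable {S : Type u} {T : Type v} {P Q R : Type}

/-- The boundary points at which some component starts, with multiplicity. -/
def starts (m : Diagram S P) : Multiset P := m.filterMap Component.source

/-- The boundary points at which some component ends, with multiplicity. -/
def ends (m : Diagram S P) : Multiset P := m.filterMap Component.target

def relabel (f : P → Q) (m : Diagram S P) : Diagram S Q := m.map (Component.relabel f)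

def subst (φ : S → List T) (m : Diagram S P) : Diagram T P := m.map (Component.subst φ)

@[simp] theorem starts_zero : starts (0 : Diagram S P) = 0 := rfl
@[simp] theorem ends_zero : ends (0 : Diagram S P) = 0 := rfl
@[simp] theorem starts_arc_none (w : List S) (b : Option P) (m : Diagram S P) :
    starts (arc none w b ::ₘ m) = starts m := Multiset.filterMap_cons_none _ _ rfl
@[simp] theorem starts_arc_some (p : P) (w : List S) (b : Option P) (m : Diagram S P) :
    starts (arc (some p) w b ::ₘ m) = p ::ₘ starts m := Multiset.filterMap_cons_some _ _ _ rfl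
@[simp] theorem starts_circle (c : Cycle S) (m : Diagram S P) :
    starts (circle c ::ₘ m) = starts m := Multiset.filterMap_cons_none _ _ rfl
@[simp] theorem ends_arc_none (w : List S) (a : Option P) (m : Diagram S P) :
    ends (arc a w none ::ₘ m) = ends m := Multiset.filterMap_cons_none _ _ rfl
@[simp] theorem ends_arc_some (p : P) (w : List S) (a : Option P) (m : Diagram S P) :
    ends (arc a w (some p) ::ₘ m) = p ::ₘ ends m := Multiset.filterMap_cons_some _ _ _ rfl
@[simp] theorem ends_circle (c : Cycle S) (m : Diagram S P) :
    ends (circle c ::ₘ m) = ends m := Multiset.filterMap_cons_none _ _ rfl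
@[simp] theorem starts_add (m n : Diagram S P) : starts (m + n) = starts m + starts n :=
  Multiset.filterMap_add _ _ _
@[simp] theorem ends_add (m n : Diagram S P) : ends (m + n) = ends m + ends n :=
  Multiset.filterMap_add _ _ _

@[simp] theorem starts_relabel (f : P → Q) (m : Diagram S P) :
    starts (relabel f m) = (starts m).map f := by
  unfold starts relabel
  rw [Multiset.filterMap_map, Multiset.map_filterMap]
  congr 1; funext c; cases c <;> rfl

@[simp] theorem ends_relabel (f : P → Q) (m : Diagram S P) :
    ends (relabel f m) = (ends m).map f := by
  unfold ends relabel
  rw [Multiset.filterMap_map, Multiset.map_filterMap]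
  congr 1; funext c; cases c <;> rfl

@[simp] theorem starts_subst (φ : S → List T) (m : Diagram S P) :
    starts (subst φ m) = starts m := by
  unfold starts subst
  rw [Multiset.filterMap_map]
  congr 1; funext c; cases c <;> rfl

@[simp] theorem ends_subst (φ : S → List T) (m : Diagram S P) :
    ends (subst φ m) = ends m := by
  unfold ends subst
  rw [Multiset.filterMap_map]
  congr 1; funext c; cases c <;> rfl

@[simp] theorem relabel_add (f : P → Q) (m n : Diagram S P) :
    relabel f (m + n) = relabel f m + relabel f n := Multiset.map_add _ _ _
@[simp] theorem relabel_cons (f : P → Q) (c : Component S P) (m : Diagram S P) :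
    relabel f (c ::ₘ m) = c.relabel f ::ₘ relabel f m := Multiset.map_cons _ _ _
@[simp] theorem relabel_zero (f : P → Q) : relabel f (0 : Diagram S P) = 0 := rfl
@[simp] theorem subst_add (φ : S → List T) (m n : Diagram S P) :
    subst φ (m + n) = subst φ m + subst φ n := Multiset.map_add _ _ _
@[simp] theorem subst_cons (φ : S → List T) (c : Component S P) (m : Diagram S P) :
    subst φ (c ::ₘ m) = c.subst φ ::ₘ subst φ m := Multiset.map_cons _ _ _

theorem relabel_relabel (f : P → Q) (g : Q → R) (m : Diagram S P) :
    relabel g (relabel f m) = relabel (g ∘ f) m := by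
  unfold relabel
  rw [Multiset.map_map]
  congr 1; funext c; cases c <;> simp [Component.relabel]

theorem relabel_id (m : Diagram S P) : relabel id m = m := by
  unfold relabel
  conv_rhs => rw [← Multiset.map_id m]
  congr 1; funext c; cases c <;> simp [Component.relabel]

theorem subst_relabel (φ : S → List T) (f : P → Q) (m : Diagram S P) :
    subst φ (relabel f m) = relabel f (subst φ m) := by
  unfold relabel subst
  rw [Multiset.map_map, Multiset.map_map]
  congr 1; funext c; cases c <;> simp [Component.relabel, Component.subst]

theorem relabel_injective {f : P → Q} (hf : f.Injective) :
    (relabel (S := S) f).Injective :=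
  Multiset.map_injective (Component.relabel_injective hf)

theorem relabel_congr {f g : P → Q} {m : Diagram S P}
    (hs : ∀ p ∈ starts m, f p = g p) (he : ∀ p ∈ ends m, f p = g p) :
    relabel f m = relabel g m := by
  induction m using Multiset.induction with
  | empty => rfl
  | cons c m ih =>
    rw [relabel_cons, relabel_cons, ih]
    · congr 1
      rcases c with ⟨_ | a, w, _ | b⟩ | c <;> simp_all [Component.relabel]
    · intro p hp; apply hs
      rcases c with ⟨_ | a, w, b⟩ | c <;> simp [hp]
    · intro p hp; apply he
      rcases c with ⟨a, w, _ | b⟩ | c <;> simp [hp]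

/-- One gluing: an end of an arc at a point `p ∈ Z` is glued to the start of an arc at the same
point, which joins two arcs into one or closes up an arc to a circle. -/
inductive Step (Z : Set P) : Diagram S P → Diagram S P → Prop
  | join (p : P) (hp : p ∈ Z) (a b : Option P) (u v : List S) (r : Diagram S P) :
      Step Z (arc a u (some p) ::ₘ arc (some p) v b ::ₘ r) (arc a (v ++ u) b ::ₘ r)
  | close (p : P) (hp : p ∈ Z) (u : List S) (r : Diagram S P) :
      Step Z (arc (some p) u (some p) ::ₘ r) (circle (u : Cycle S) ::ₘ r)

/-- Finitely many gluings. -/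
def Reduces (Z : Set P) : Diagram S P → Diagram S P → Prop := ReflTransGen (Step Z)

theorem Step.add_right {Z : Set P} {m m' : Diagram S P} (h : Step Z m m') (r : Diagram S P) :
    Step Z (m + r) (m' + r) := by
  cases h with
  | join p hp a b u v s => simpa using Step.join p hp a b u v (s + r)
  | close p hp u s => simpa using Step.close p hp u (s + r)

theorem Reduces.add_right {Z : Set P} {m m' : Diagram S P} (h : Reduces Z m m')
    (r : Diagram S P) : Reduces Z (m + r) (m' + r) :=
  ReflTransGen.lift (p := Step Z) (· + r) (fun _ _ h => Step.add_right h r) _ _ h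

theorem Reduces.add_left {Z : Set P} {m m' : Diagram S P} (h : Reduces Z m m')
    (r : Diagram S P) : Reduces Z (r + m) (r + m') := by
  rw [add_comm r, add_comm r]; exact h.add_right r

theorem Step.relabel {Z : Set P} {Z' : Set Q} {m m' : Diagram S P} (h : Step Z m m')
    (f : P → Q) (hf : ∀ p ∈ Z, f p ∈ Z') : Step Z' (m.relabel f) (m'.relabel f) := by
  cases h with
  | join p hp a b u v s =>
    simpa [Component.relabel] using Step.join (f p) (hf p hp) (a.map f) (b.map f) u v (s.relabel f)
  | close p hp u s =>
    simpa [Component.relabel] using Step.close (f p) (hf p hp) u (s.relabel f)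

theorem Reduces.relabel {Z : Set P} {Z' : Set Q} {m m' : Diagram S P} (h : Reduces Z m m')
    (f : P → Q) (hf : ∀ p ∈ Z, f p ∈ Z') : Reduces Z' (m.relabel f) (m'.relabel f) :=
  ReflTransGen.lift (p := Step Z') (Diagram.relabel f) (fun _ _ h => Step.relabel h f hf) _ _ h

theorem Step.subst {Z : Set P} {m m' : Diagram S P} (h : Step Z m m') (φ : S → List T) :
    Step Z (m.subst φ) (m'.subst φ) := by
  cases h with
  | join p hp a b u v s =>
    simpa [Component.subst] using
      Step.join p hp a b (u.flatMap φ) (v.flatMap φ) (s.subst φ)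
  | close p hp u s =>
    simpa [Component.subst] using Step.close p hp (u.flatMap φ) (s.subst φ)

theorem Reduces.subst {Z : Set P} {m m' : Diagram S P} (h : Reduces Z m m') (φ : S → List T) :
    Reduces Z (m.subst φ) (m'.subst φ) :=
  ReflTransGen.lift (p := Step Z) (Diagram.subst φ) (fun _ _ h => Step.subst h φ) _ _ h

theorem Step.starts_eq {Z : Set P} {m m' : Diagram S P} (h : Step Z m m') :
    ∃ p ∈ Z, starts m = p ::ₘ starts m' ∧ ends m = p ::ₘ ends m' := by
  cases h with
  | join p hp a b u v s =>
    refine ⟨p, hp, ?_, ?_⟩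
    · cases a <;> simp [Multiset.cons_swap]
    · cases b <;> simp
  | close p hp u s => exact ⟨p, hp, by simp, by simp⟩

theorem Step.hasInnerEnd {Z : Set P} {m m' : Diagram S P} (h : Step Z m m') :
    (∃ c ∈ m', c.HasInnerEnd) ↔ ∃ c ∈ m, c.HasInnerEnd := by
  cases h with
  | join p hp a b u v s =>
    simp only [Multiset.mem_cons, exists_eq_or_imp, HasInnerEnd, reduceCtorEq, or_false, false_or]
    tauto
  | close p hp u s =>
    simp [HasInnerEnd]

theorem Reduces.hasInnerEnd {Z : Set P} {m m' : Diagram S P} (h : Reduces Z m m') :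
    (∃ c ∈ m', c.HasInnerEnd) ↔ ∃ c ∈ m, c.HasInnerEnd := by
  induction h with
  | refl => rfl
  | tail _ h ih => rw [h.hasInnerEnd, ih]

/-- Each boundary point is the start of at most one component and the end of at most one. -/
def Linear (m : Diagram S P) : Prop := (starts m).Nodup ∧ (ends m).Nodup

theorem Step.linear {Z : Set P} {m m' : Diagram S P} (h : Step Z m m') (hm : Linear m) :
    Linear m' := by
  obtain ⟨p, -, hs, he⟩ := h.starts_eq
  obtain ⟨h1, h2⟩ := hm
  rw [hs] at h1; rw [he] at h2
  exact ⟨(Multiset.nodup_cons.1 h1).2, (Multiset.nodup_cons.1 h2).2⟩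

theorem circle_append_comm (u v : List S) :
    (circle ((u ++ v : List S) : Cycle S) : Component S P) = circle ((v ++ u : List S) : Cycle S) := by
  congr 1
  exact Cycle.coe_eq_coe.2 List.isRotated_append

theorem Step.diamond {Z : Set P} {m m₁ m₂ : Diagram S P} (hm : Linear m)
    (h₁ : Step Z m m₁) (h₂ : Step Z m m₂) :
    m₁ = m₂ ∨ ∃ d, Step Z m₁ d ∧ Step Z m₂ d := by
  have key : ∀ (p : P) (hp : p ∈ Z) (u : List S) (r : Diagram S P) (q : P) (hq : q ∈ Z)
      (a b : Option P) (s t : List S) (r' : Diagram S P),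
      m = arc (some p) u (some p) ::ₘ r →
      m = arc a s (some q) ::ₘ arc (some q) t b ::ₘ r' →
      ∃ d, Step Z (circle (u : Cycle S) ::ₘ r) d ∧ Step Z (arc a (t ++ s) b ::ₘ r') d := by
    intro p hp u r q hq a b s t r' e1 e2
    have e := e1.symm.trans e2
    rcases Multiset.cons_eq_cons.1 e with ⟨h, hr⟩ | ⟨-, cs, hr, hr'⟩
    · exfalso
      simp only [arc.injEq, Option.some.injEq] at h
      obtain ⟨rfl, rfl, rfl⟩ := h
      have := hm.1
      rw [e2] at this
      simp at this
    · rcases Multiset.cons_eq_cons.1 hr' with ⟨h, hr''⟩ | ⟨-, ds, hd, hd'⟩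
      · exfalso
        simp only [arc.injEq, Option.some.injEq] at h
        obtain ⟨rfl, rfl, rfl⟩ := h
        have := hm.2
        rw [e2] at this
        simp at this
      · subst hr hd hd'
        refine ⟨arc a (t ++ s) b ::ₘ circle (u : Cycle S) ::ₘ ds, ?_, ?_⟩
        · have := Step.join q hq a b s t (circle (u : Cycle S) ::ₘ ds)
          rwa [Multiset.cons_swap _ (circle _), Multiset.cons_swap _ (circle _)] at this
        · have := Step.close p hp u (arc a (t ++ s) b ::ₘ ds)
          rwa [Multiset.cons_swap, Multiset.cons_swap (circle _)] at this
  generalize hM : m = M at h₁ h₂ 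
  cases h₁ with
  | close p hp u r =>
    generalize hM' : arc (some p) u (some p) ::ₘ r = M' at h₂
    cases h₂ with
    | join q hq a b s t r' =>
      exact Or.inr (key p hp u r q hq a b s t r' hM (hM.trans hM'))
    | close q hq s r' =>
      rcases Multiset.cons_eq_cons.1 hM' with ⟨h, hr⟩ | ⟨-, cs, hr, hr'⟩
      · left
        simp only [arc.injEq, Option.some.injEq] at h
        rw [h.2.1, hr]
      · right
        subst hr hr'
        refine ⟨circle (u : Cycle S) ::ₘ circle (s : Cycle S) ::ₘ cs, ?_, ?_⟩
        · rw [Multiset.cons_swap, Multiset.cons_swap (circle (u : Cycle S))]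
          exact Step.close q hq s _
        · rw [Multiset.cons_swap]
          exact Step.close p hp u _
  | join p hp a b u v r =>
    generalize hM' : arc a u (some p) ::ₘ arc (some p) v b ::ₘ r = M' at h₂
    cases h₂ with
    | close q hq s r' =>
      right
      obtain ⟨d, h1, h2⟩ := key q hq s r' p hp a b u v r (hM.trans hM') hM
      exact ⟨d, h2, h1⟩
    | join q hq a' b' u' v' r' =>
      have hM2 := hM.trans hM'
      have hs := hm.1
      have he := hm.2
      rcases Multiset.cons_eq_cons.1 hM' with ⟨h, hr⟩ | ⟨-, cs, hr, hr'⟩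
      · simp only [arc.injEq, Option.some.injEq] at h
        obtain ⟨rfl, rfl, rfl⟩ := h
        rcases Multiset.cons_eq_cons.1 hr with ⟨h, hr2⟩ | ⟨-, cs, hr2, hr'⟩
        · simp only [arc.injEq] at h
          obtain ⟨-, rfl, rfl⟩ := h
          left; rw [hr2]
        · exfalso
          rw [hM, hr2] at hs
          cases a <;> simp at hs
      · rcases Multiset.cons_eq_cons.1 hr with ⟨h, hr2⟩ | ⟨-, es, hes, hes'⟩
        · simp only [arc.injEq] at h
          obtain ⟨rfl, rfl, rfl⟩ := h
          subst hr2
          rcases Multiset.cons_eq_cons.1 hr' with ⟨h, hr3⟩ | ⟨-, ds, hd, hd'⟩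
          · simp only [arc.injEq] at h
            obtain ⟨rfl, rfl, rfl⟩ := h
            subst hr3
            right
            refine ⟨circle ((v ++ v' : List S) : Cycle S) ::ₘ r', Step.close q hq _ _, ?_⟩
            rw [circle_append_comm]
            exact Step.close p hp _ _
          · subst hd hd'
            right
            refine ⟨arc a (v' ++ (v ++ u)) b' ::ₘ ds, Step.join q hq _ _ _ _ _, ?_⟩
            rw [Multiset.cons_swap, ← List.append_assoc]
            exact Step.join p hp _ _ _ _ _
        · subst hes hes'
          rcases Multiset.cons_eq_cons.1 hr' with ⟨h, hr2⟩ | ⟨-, fs, hf, hf'⟩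
          · simp only [arc.injEq] at h
            obtain ⟨rfl, rfl, rfl⟩ := h
            subst hr2
            right
            refine ⟨arc a' (v ++ (v' ++ u')) b ::ₘ es, ?_, Step.join p hp _ _ _ _ _⟩
            rw [Multiset.cons_swap, ← List.append_assoc]
            exact Step.join q hq _ _ _ _ _
          · subst hf
            rcases Multiset.cons_eq_cons.1 hf' with ⟨h, hr⟩ | ⟨-, gs, hg, hg'⟩
            · exfalso
              simp only [arc.injEq, Option.some.injEq] at h
              obtain ⟨rfl, rfl, rfl⟩ := h
              rw [hM] at he
              cases b <;> simp at he
            · subst hg hg'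
              right
              refine ⟨arc a (v ++ u) b ::ₘ arc a' (v' ++ u') b' ::ₘ gs, ?_, ?_⟩
              · have := Step.join q hq a' b' u' v' (arc a (v ++ u) b ::ₘ gs)
                rwa [Multiset.cons_swap (arc (some q) v' b'), Multiset.cons_swap,
                  Multiset.cons_swap (arc a' (v' ++ u') b')] at this
              · have := Step.join p hp a b u v (arc a' (v' ++ u') b' ::ₘ gs)
                rwa [Multiset.cons_swap (arc (some p) v b), Multiset.cons_swap] at this

theorem Reduces.linear {Z : Set P} {m m' : Diagram S P} (h : Reduces Z m m') (hm : Linear m) :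
    Linear m' := by
  induction h with
  | refl => exact hm
  | tail _ h ih => exact h.linear ih

theorem Reduces.unique {Z : Set P} {m m₁ m₂ : Diagram S P} (hm : Linear m)
    (h₁ : Reduces Z m m₁) (h₂ : Reduces Z m m₂) (hz₁ : ∀ p ∈ starts m₁, p ∉ Z)
    (hz₂ : ∀ p ∈ starts m₂, p ∉ Z) : m₁ = m₂ := by
  let r : Diagram S P → Diagram S P → Prop := fun a b => Linear a ∧ Step Z a b
  have lift : ∀ {m'}, Reduces Z m m' → ReflTransGen r m m' := by
    intro m' h
    induction h with
    | refl => exact .refl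
    | tail h0 h ih => exact ih.tail ⟨Reduces.linear h0 hm, h⟩
  obtain ⟨d, hd₁, hd₂⟩ := church_rosser (r := r) (by
    rintro a b c ⟨ha, hab⟩ ⟨-, hac⟩
    rcases Step.diamond ha hab hac with rfl | ⟨d, hb, hc⟩
    · exact ⟨b, .refl, .refl⟩
    · exact ⟨d, .single ⟨hab.linear ha, hb⟩, .single ⟨hac.linear ha, hc⟩⟩) (lift h₁) (lift h₂)
  have nf : ∀ {a b : Diagram S P}, (∀ p ∈ starts a, p ∉ Z) → ReflTransGen r a b → a = b := by
    intro a b ha h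
    rcases ReflTransGen.cases_head h with rfl | ⟨c, ⟨-, hc⟩, -⟩
    · rfl
    · obtain ⟨p, hp, hs, -⟩ := hc.starts_eq
      exact absurd hp (ha p (by simp [hs]))
  rw [nf hz₁ hd₁, nf hz₂ hd₂]

theorem exists_step {Z : Set P} {m : Diagram S P} {p : P} (hp : p ∈ Z) (hs : p ∈ starts m)
    (he : p ∈ ends m) : ∃ m', Step Z m m' := by
  obtain ⟨c, hc, hcs⟩ := (Multiset.mem_filterMap _ _).1 hs
  obtain ⟨d, hd, hde⟩ := (Multiset.mem_filterMap _ _).1 he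
  obtain ⟨r, rfl⟩ := Multiset.exists_cons_of_mem hc
  rcases Multiset.mem_cons.1 hd with rfl | hd
  · rcases d with ⟨a, w, b⟩ | c
    · simp only [source, target] at hcs hde
      subst hcs hde
      exact ⟨_, Step.close p hp w r⟩
    · simp [source] at hcs
  · obtain ⟨r, rfl⟩ := Multiset.exists_cons_of_mem hd
    rcases d with ⟨a, w, b⟩ | d
    · rcases c with ⟨a', w', b'⟩ | c
      · simp only [source, target] at hcs hde
        subst hcs hde
        rw [Multiset.cons_swap]
        exact ⟨_, Step.join p hp a b' w w' r⟩
      · simp [source] at hcs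
    · simp [target] at hde

theorem exists_reduces {Z : Set P} {m : Diagram S P} (hm : Linear m)
    (h : ∀ p ∈ Z, p ∈ starts m ↔ p ∈ ends m) :
    ∃ m', Reduces Z m m' ∧ Linear m' ∧
      (∀ p, p ∈ starts m' ↔ p ∈ starts m ∧ p ∉ Z) ∧ (∀ p, p ∈ ends m' ↔ p ∈ ends m ∧ p ∉ Z) := by
  induction hn : Multiset.card (starts m) generalizing m with
  | zero =>
    have h0 : starts m = 0 := Multiset.card_eq_zero.1 hn
    refine ⟨m, .refl, hm, by simp [h0], fun p => ⟨fun hp => ⟨hp, fun hz => ?_⟩, fun hp => hp.1⟩⟩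
    have := (h p hz).2 hp
    simp [h0] at this
  | succ n ih =>
    by_cases hz : ∃ p ∈ Z, p ∈ starts m
    · obtain ⟨p, hpz, hps⟩ := hz
      obtain ⟨m₁, h₁⟩ := exists_step hpz hps ((h p hpz).1 hps)
      obtain ⟨q, hq, hs, he⟩ := h₁.starts_eq
      have hns := hm.1
      have hne := hm.2
      rw [hs, Multiset.nodup_cons] at hns
      rw [he, Multiset.nodup_cons] at hne
      obtain ⟨m', hr, hl, hs', he'⟩ := ih (h₁.linear hm) (by
        intro x hx
        have := h x hx
        rw [hs, he, Multiset.mem_cons, Multiset.mem_cons] at this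
        by_cases hxq : x = q
        · subst hxq; exact iff_of_false hns.1 hne.1
        · simpa [hxq] using this) (by rw [hs, Multiset.card_cons] at hn; omega)
      refine ⟨m', .head h₁ hr, hl, fun x => ?_, fun x => ?_⟩
      · rw [hs', hs, Multiset.mem_cons]
        constructor
        · rintro ⟨a, b⟩; exact ⟨Or.inr a, b⟩
        · rintro ⟨rfl | a, b⟩
          · exact absurd hq b
          · exact ⟨a, b⟩
      · rw [he', he, Multiset.mem_cons]
        constructor
        · rintro ⟨a, b⟩; exact ⟨Or.inr a, b⟩
        · rintro ⟨rfl | a, b⟩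
          · exact absurd hq b
          · exact ⟨a, b⟩
    · push Not at hz
      exact ⟨m, .refl, hm, fun p => ⟨fun hp => ⟨hp, fun h => hz p h hp⟩, fun hp => hp.1⟩,
        fun p => ⟨fun hp => ⟨hp, fun hh => hz p hh ((h p hh).2 hp)⟩, fun hp => hp.1⟩⟩

theorem exists_relabel_eq {E : Type} (e : E → P) (m : Diagram S P)
    (hs : ∀ p ∈ starts m, p ∈ Set.range e) (he : ∀ p ∈ ends m, p ∈ Set.range e) :
    ∃ d : Diagram S E, relabel e d = m := by
  induction m using Multiset.induction with
  | empty => exact ⟨0, rfl⟩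
  | cons c m ih =>
    obtain ⟨d, rfl⟩ := ih
      (fun p hp => hs p (by rcases c with ⟨_ | a, w, b⟩ | c <;> simp [hp]))
      (fun p hp => he p (by rcases c with ⟨a, w, _ | b⟩ | c <;> simp [hp]))
    rcases c with ⟨a, w, b⟩ | c
    · have ha : ∃ a', Option.map e a' = a := by
        rcases a with _ | a
        · exact ⟨none, rfl⟩
        · obtain ⟨x, rfl⟩ := hs a (by simp)
          exact ⟨some x, rfl⟩
      have hb : ∃ b', Option.map e b' = b := by
        rcases b with _ | b
        · exact ⟨none, rfl⟩
        · obtain ⟨x, rfl⟩ := he b (by simp)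
          exact ⟨some x, rfl⟩
      obtain ⟨a, rfl⟩ := ha
      obtain ⟨b, rfl⟩ := hb
      exact ⟨arc a w b ::ₘ d, by simp [Component.relabel]⟩
    · exact ⟨circle c ::ₘ d, by simp [Component.relabel]⟩

open Classical in
/-- Glue a diagram at all points outside the range of `e : E → P`; the result is a diagram with
boundary points in `E`. It is the unique diagram `d` to which `m` reduces by gluings
(see `glue_eq`); for diagrams that cannot be glued the value is irrelevant. -/
noncomputable def glue {E : Type} (e : E → P) (m : Diagram S P) : Diagram S E :=
  if h : ∃ d : Diagram S E, Reduces (Set.range e)ᶜ m (relabel e d) then h.choose else 0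

theorem glue_eq {E : Type} {e : E → P} (hinj : e.Injective) {m : Diagram S P} (hm : Linear m)
    {d : Diagram S E} (h : Reduces (Set.range e)ᶜ m (relabel e d)) : glue e m = d := by
  have hex : ∃ d : Diagram S E, Reduces (Set.range e)ᶜ m (relabel e d) := ⟨d, h⟩
  have : glue e m = hex.choose := dif_pos hex
  rw [this]
  refine relabel_injective hinj (Reduces.unique hm hex.choose_spec h ?_ ?_) <;>
  · intro p hp
    simp only [starts_relabel, Multiset.mem_map] at hp
    obtain ⟨x, -, rfl⟩ := hp
    simp

/-- A diagram all of whose points outside the range of `e` can be glued. -/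
structure Gluable {E : Type} (e : E → P) (m : Diagram S P) : Prop where
  inj : e.Injective
  linear : Linear m
  iff : ∀ p, p ∉ Set.range e → (p ∈ starts m ↔ p ∈ ends m)

theorem Gluable.exists {E : Type} {e : E → P} {m : Diagram S P} (h : Gluable e m) :
    ∃ d : Diagram S E, Reduces (Set.range e)ᶜ m (relabel e d) ∧ Linear d ∧
      (∀ p, p ∈ starts d ↔ e p ∈ starts m) ∧ (∀ p, p ∈ ends d ↔ e p ∈ ends m) := by
  obtain ⟨m', hr, hl, hs, he⟩ := exists_reduces (Z := (Set.range e)ᶜ) h.linear h.iff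
  obtain ⟨d, rfl⟩ := exists_relabel_eq e m'
    (fun p hp => by simpa using ((hs p).1 hp).2) (fun p hp => by simpa using ((he p).1 hp).2)
  refine ⟨d, hr, ⟨?_, ?_⟩, fun p => ?_, fun p => ?_⟩
  · exact Multiset.Nodup.of_map _ (by simpa using hl.1)
  · exact Multiset.Nodup.of_map _ (by simpa using hl.2)
  · simpa [h.inj.eq_iff] using hs (e p)
  · simpa [h.inj.eq_iff] using he (e p)

theorem Gluable.reduces {E : Type} {e : E → P} {m : Diagram S P} (h : Gluable e m) :
    Reduces (Set.range e)ᶜ m (relabel e (glue e m)) := by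
  obtain ⟨d, hd, -⟩ := h.exists
  rwa [glue_eq h.inj h.linear hd]

theorem Gluable.glue_linear {E : Type} {e : E → P} {m : Diagram S P} (h : Gluable e m) :
    Linear (glue e m) := by
  obtain ⟨d, hd, hl, -⟩ := h.exists
  rwa [glue_eq h.inj h.linear hd]

theorem Gluable.mem_starts {E : Type} {e : E → P} {m : Diagram S P} (h : Gluable e m) (p : E) :
    p ∈ starts (glue e m) ↔ e p ∈ starts m := by
  obtain ⟨d, hd, hl, hs, -⟩ := h.exists
  rw [glue_eq h.inj h.linear hd, hs]

theorem Gluable.mem_ends {E : Type} {e : E → P} {m : Diagram S P} (h : Gluable e m) (p : E) :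
    p ∈ ends (glue e m) ↔ e p ∈ ends m := by
  obtain ⟨d, hd, hl, -, he⟩ := h.exists
  rw [glue_eq h.inj h.linear hd, he]

theorem Gluable.hasInnerEnd {E : Type} {e : E → P} {m : Diagram S P} (h : Gluable e m) :
    (∃ c ∈ glue e m, c.HasInnerEnd) ↔ ∃ c ∈ m, c.HasInnerEnd := by
  rw [← h.reduces.hasInnerEnd]
  simp [relabel]

theorem Gluable.subst {E : Type} {e : E → P} {m : Diagram S P} (h : Gluable e m)
    (φ : S → List T) : glue e (m.subst φ) = (glue e m).subst φ := by
  refine glue_eq h.inj ?_ ?_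
  · simpa [Linear] using h.linear
  · rw [← subst_relabel]
    exact h.reduces.subst φ

end Diagram


open Relation

namespace Diagram

open Component

variable {S : Type u} {T : Type v} {P Q R : Type}

/-- A diagram whose boundary is the set `P` of points: the point `p` is the start of exactly one
component and the end of none if `o p = true`, and the end of exactly one component and the start
of none if `o p = false`. -/
structure HasBoundary (o : P → Bool) (m : Diagram S P) : Prop where
  linear : Linear m
  mem_starts : ∀ p, p ∈ starts m ↔ o p = true
  mem_ends : ∀ p, p ∈ ends m ↔ o p = false

/-- An undecorated arc between `x` and `y`, from `x` to `y` if `o = true`. -/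
def plainArc (o : Bool) (x y : P) : Component S P :=
  if o then arc (some x) [] (some y) else arc (some y) [] (some x)

theorem plainArc_not (o : Bool) (x y : P) :
    (plainArc (!o) x y : Component S P) = plainArc o y x := by
  cases o <;> rfl

theorem relabel_plainArc (o : Bool) (x y : P) (f : P → Q) :
    (plainArc o x y : Component S P).relabel f = plainArc o (f x) (f y) := by
  cases o <;> rfl

theorem subst_plainArc (o : Bool) (x y : P) (φ : S → List T) :
    (plainArc o x y : Component S P).subst φ = plainArc o x y := by
  cases o <;> rfl

theorem not_hasInnerEnd_plainArc (o : Bool) (x y : P) :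
    ¬ (plainArc o x y : Component S P).HasInnerEnd := by
  cases o <;> simp [plainArc, HasInnerEnd]

theorem starts_map_plainArc {ι : Type} (s : Multiset ι) (o : ι → Bool) (x y : ι → P) :
    starts (s.map fun i => (plainArc (o i) (x i) (y i) : Component S P)) =
      s.map fun i => if o i then x i else y i := by
  induction s using Multiset.induction with
  | empty => rfl
  | cons i s ih =>
    rw [Multiset.map_cons, Multiset.map_cons, ← ih]
    cases h : o i <;> simp [plainArc]

theorem ends_map_plainArc {ι : Type} (s : Multiset ι) (o : ι → Bool) (x y : ι → P) :
    ends (s.map fun i => (plainArc (o i) (x i) (y i) : Component S P)) =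
      s.map fun i => if o i then y i else x i := by
  induction s using Multiset.induction with
  | empty => rfl
  | cons i s ih =>
    rw [Multiset.map_cons, Multiset.map_cons, ← ih]
    cases h : o i <;> simp [plainArc]

theorem reduces_plainArc [DecidableEq P] {o : P → Bool} {x : Diagram S P} (hx : HasBoundary o x)
    {Z : Set Q} (f g : P → Q) (s : Finset P) (hf : ∀ p ∈ s, f p ∈ Z) :
    Reduces Z ((s.val.map fun p => (plainArc (o p) (g p) (f p) : Component S Q)) +
      relabel (fun p => if p ∈ s then f p else g p) x) (relabel g x) := by
  induction s using Finset.induction with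
  | empty =>
    simp only [Finset.notMem_empty, if_false, Finset.empty_val, Multiset.map_zero, zero_add]
    exact ReflTransGen.refl
  | insert p s hp ih =>
    refine .head ?_ (ih fun q hq => hf q (Finset.mem_insert_of_mem hq))
    rw [Finset.insert_val_of_notMem hp, Multiset.map_cons, Multiset.cons_add, add_comm,
      ← Multiset.cons_add, add_comm (Multiset.map _ _)]
    refine Step.add_right ?_ _
    have hfp := hf p (Finset.mem_insert_self _ _)
    cases ho : o p with
    | true =>
      have hps := (hx.mem_starts p).2 ho
      have hpe : p ∉ ends x := by rw [hx.mem_ends, ho]; simp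
      obtain ⟨c, hc, hcs⟩ := (Multiset.mem_filterMap _ _).1 hps
      obtain ⟨r, rfl⟩ := Multiset.exists_cons_of_mem hc
      rcases c with ⟨a, w, b⟩ | c
      · simp only [source] at hcs
        subst hcs
        have hl := hx.linear.1
        rw [starts_arc_some, Multiset.nodup_cons] at hl
        have hpr : p ∉ ends r := fun h => hpe (by cases b <;> simp [h])
        have e1 : relabel (fun q => if q ∈ insert p s then f q else g q) r =
            relabel (fun q => if q ∈ s then f q else g q) r := by
          refine relabel_congr (fun q hq => ?_) (fun q hq => ?_)
          · have : q ≠ p := by rintro rfl; exact hl.1 hq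
            simp [this]
          · have : q ≠ p := by rintro rfl; exact hpr hq
            simp [this]
        have e2 : b.map (fun q => if q ∈ insert p s then f q else g q) =
            b.map (fun q => if q ∈ s then f q else g q) := by
          rcases b with _ | q
          · rfl
          · have : q ≠ p := by rintro rfl; exact hpe (by simp)
            simp [this]
        rw [relabel_cons, relabel_cons, e1]
        simp only [Component.relabel, e2]
        simpa [plainArc, hp] using Step.join (S := S) (f p) hfp (some (g p))
          (b.map (fun q => if q ∈ s then f q else g q)) [] w
          (relabel (fun q => if q ∈ s then f q else g q) r)
      · simp [source] at hcs
    | false =>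
      have hps := (hx.mem_ends p).2 ho
      have hpe : p ∉ starts x := by rw [hx.mem_starts, ho]; simp
      obtain ⟨c, hc, hcs⟩ := (Multiset.mem_filterMap _ _).1 hps
      obtain ⟨r, rfl⟩ := Multiset.exists_cons_of_mem hc
      rcases c with ⟨b, w, a⟩ | c
      · simp only [target] at hcs
        subst hcs
        have hl := hx.linear.2
        rw [ends_arc_some, Multiset.nodup_cons] at hl
        have hpr : p ∉ starts r := fun h => hpe (by cases b <;> simp [h])
        have e1 : relabel (fun q => if q ∈ insert p s then f q else g q) r =
            relabel (fun q => if q ∈ s then f q else g q) r := by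
          refine relabel_congr (fun q hq => ?_) (fun q hq => ?_)
          · have : q ≠ p := by rintro rfl; exact hpr hq
            simp [this]
          · have : q ≠ p := by rintro rfl; exact hl.1 hq
            simp [this]
        have e2 : b.map (fun q => if q ∈ insert p s then f q else g q) =
            b.map (fun q => if q ∈ s then f q else g q) := by
          rcases b with _ | q
          · rfl
          · have : q ≠ p := by rintro rfl; exact hpe (by simp)
            simp [this]
        rw [relabel_cons, relabel_cons, e1]
        simp only [Component.relabel, e2]
        rw [Multiset.cons_swap]
        simpa [plainArc, hp] using Step.join (S := S) (f p) hfp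
          (b.map (fun q => if q ∈ s then f q else g q)) (some (g p)) w []
          (relabel (fun q => if q ∈ s then f q else g q) r)
      · simp [target] at hcs

end Diagram

/-- Finite sequences of signs (`true` is `+`, `false` is `-`). -/
@[ext] structure SignSeq : Type where
  signs : List Bool

namespace SignSeq

/-- The points of the zero-manifold of a sign sequence. -/
abbrev Pt (X : SignSeq) : Type := Fin X.signs.length

/-- The sign of a point. -/
def sign (X : SignSeq) (i : X.Pt) : Bool := X.signs.get i

/-- The boundary orientation of a cobordism from `X` (bottom) to `Y` (top): components start at
the positive points of `X` and the negative points of `Y`, and end at the other boundary points. -/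
def orient (X Y : SignSeq) : X.Pt ⊕ Y.Pt → Bool :=
  Sum.elim X.sign (fun j => !Y.sign j)

end SignSeq

/-- A decorated cobordism from `X` to `Y`, up to diffeomorphism rel boundary. -/
@[ext] structure Cobordism (S : Type u) (inner : Bool) (X Y : SignSeq) : Type u where
  comps : Diagram S (X.Pt ⊕ Y.Pt)
  boundary : comps.HasBoundary (X.orient Y)
  not_inner : inner = false → ∀ c ∈ comps, ¬ c.HasInnerEnd

namespace Cobordism

open Diagram Component

variable {S : Type u} {T : Type v} {inner : Bool}

/-- The identity cobordism: one undecorated through arc for each point. -/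
def id (X : SignSeq) : Cobordism S inner X X where
  comps := (Finset.univ : Finset X.Pt).val.map fun i =>
    plainArc (X.sign i) (Sum.inl i) (Sum.inr i)
  boundary := by
    refine ⟨⟨?_, ?_⟩, ?_, ?_⟩
    · rw [starts_map_plainArc]
      refine Multiset.Nodup.map ?_ Finset.univ.nodup
      intro i j h
      cases hi : X.sign i <;> cases hj : X.sign j <;> simp_all
    · rw [ends_map_plainArc]
      refine Multiset.Nodup.map ?_ Finset.univ.nodup
      intro i j h
      cases hi : X.sign i <;> cases hj : X.sign j <;> simp_all
    · rw [starts_map_plainArc]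
      rintro (i | i) <;> simp only [Multiset.mem_map, Finset.mem_val, Finset.mem_univ, true_and,
        SignSeq.orient, Sum.elim_inl, Sum.elim_inr]
      · constructor
        · rintro ⟨j, hj⟩
          cases hs : X.sign j <;> simp_all
        · intro h; exact ⟨i, by simp [h]⟩
      · constructor
        · rintro ⟨j, hj⟩
          cases hs : X.sign j <;> simp_all
        · intro h; exact ⟨i, by simpa using h⟩
    · rw [ends_map_plainArc]
      rintro (i | i) <;> simp only [Multiset.mem_map, Finset.mem_val, Finset.mem_univ, true_and,
        SignSeq.orient, Sum.elim_inl, Sum.elim_inr]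
      · constructor
        · rintro ⟨j, hj⟩
          cases hs : X.sign j <;> simp_all
        · intro h; exact ⟨i, by simp [h]⟩
      · constructor
        · rintro ⟨j, hj⟩
          cases hs : X.sign j <;> simp_all
        · intro h; exact ⟨i, by simpa using h⟩
  not_inner := by
    rintro - c hc
    obtain ⟨i, -, rfl⟩ := Multiset.mem_map.1 hc
    exact not_hasInnerEnd_plainArc _ _ _

/-- The disjoint union of two composable cobordisms, with all boundary points kept; the points of
the middle object `Y` occur once as a start and once as an end. -/
def stack {X Y Z : SignSeq} (x : Cobordism S inner X Y) (y : Cobordism S inner Y Z) :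
    Diagram S (X.Pt ⊕ (Y.Pt ⊕ Z.Pt)) :=
  x.comps.relabel (Sum.map _root_.id Sum.inl) + y.comps.relabel Sum.inr

theorem mem_starts_stack {X Y Z : SignSeq} (x : Cobordism S inner X Y)
    (y : Cobordism S inner Y Z) (p : X.Pt ⊕ (Y.Pt ⊕ Z.Pt)) :
    p ∈ starts (stack x y) ↔
      Sum.elim (fun i => X.sign i = true) (Sum.elim (fun _ => True) (fun k => Z.sign k = false)) p := by
  have hx := x.boundary.mem_starts
  have hy := y.boundary.mem_starts
  rcases p with i | j | k <;> simp [stack, hx, hy, SignSeq.orient]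

theorem mem_ends_stack {X Y Z : SignSeq} (x : Cobordism S inner X Y)
    (y : Cobordism S inner Y Z) (p : X.Pt ⊕ (Y.Pt ⊕ Z.Pt)) :
    p ∈ ends (stack x y) ↔
      Sum.elim (fun i => X.sign i = false) (Sum.elim (fun _ => True) (fun k => Z.sign k = true)) p := by
  have hx := x.boundary.mem_ends
  have hy := y.boundary.mem_ends
  rcases p with i | j | k <;> simp [stack, hx, hy, SignSeq.orient]

theorem sumMap_inl_injective {A B C : Type} :
    (Sum.map _root_.id Sum.inl : A ⊕ B → A ⊕ (B ⊕ C)).Injective :=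
  Function.injective_id.sumMap Sum.inl_injective

theorem sumMap_inr_injective {A B C : Type} :
    (Sum.map _root_.id Sum.inr : A ⊕ C → A ⊕ (B ⊕ C)).Injective :=
  Function.injective_id.sumMap Sum.inr_injective

theorem linear_add_relabel {P Q R : Type} {m : Diagram S P} {n : Diagram S Q} {f : P → R}
    {g : Q → R} (hm : Linear m) (hn : Linear n) (hf : f.Injective) (hg : g.Injective)
    (h : ∀ p q, f p = g q → (p ∈ starts m → q ∉ starts n) ∧ (p ∈ ends m → q ∉ ends n)) :
    Linear (m.relabel f + n.relabel g) := by
  constructor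
  · rw [starts_add, starts_relabel, starts_relabel, Multiset.nodup_add, Multiset.disjoint_left]
    refine ⟨hm.1.map hf, hn.1.map hg, ?_⟩
    rintro p h1 h2
    obtain ⟨a, ha, rfl⟩ := Multiset.mem_map.1 h1
    obtain ⟨b, hb, hab⟩ := Multiset.mem_map.1 h2
    exact (h a b hab.symm).1 ha hb
  · rw [ends_add, ends_relabel, ends_relabel, Multiset.nodup_add, Multiset.disjoint_left]
    refine ⟨hm.2.map hf, hn.2.map hg, ?_⟩
    rintro p h1 h2
    obtain ⟨a, ha, rfl⟩ := Multiset.mem_map.1 h1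
    obtain ⟨b, hb, hab⟩ := Multiset.mem_map.1 h2
    exact (h a b hab.symm).2 ha hb

theorem linear_stack {X Y Z : SignSeq} (x : Cobordism S inner X Y)
    (y : Cobordism S inner Y Z) : Linear (stack x y) := by
  refine linear_add_relabel x.boundary.linear y.boundary.linear sumMap_inl_injective
    Sum.inr_injective ?_
  intro p q hpq
  rw [x.boundary.mem_starts, x.boundary.mem_ends, y.boundary.mem_starts, y.boundary.mem_ends]
  rcases p with p | p <;> rcases q with q | q <;> simp at hpq
  subst hpq
  simp [SignSeq.orient]

theorem gluable_stack {X Y Z : SignSeq} (x : Cobordism S inner X Y)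
    (y : Cobordism S inner Y Z) :
    Gluable (Sum.map _root_.id Sum.inr : X.Pt ⊕ Z.Pt → X.Pt ⊕ (Y.Pt ⊕ Z.Pt)) (stack x y) := by
  refine ⟨sumMap_inr_injective, linear_stack x y, fun p hp => ?_⟩
  rw [mem_starts_stack, mem_ends_stack]
  rcases p with i | j | k
  · exact absurd ⟨Sum.inl i, rfl⟩ hp
  · simp
  · exact absurd ⟨Sum.inr k, rfl⟩ hp

/-- Composition: concatenate the cobordisms and glue along the middle points. -/
noncomputable def comp {X Y Z : SignSeq} (x : Cobordism S inner X Y)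
    (y : Cobordism S inner Y Z) : Cobordism S inner X Z where
  comps := glue (Sum.map _root_.id Sum.inr) (stack x y)
  boundary := by
    refine ⟨(gluable_stack x y).glue_linear, fun p => ?_, fun p => ?_⟩
    · rw [(gluable_stack x y).mem_starts, mem_starts_stack]
      rcases p with i | k <;> simp [SignSeq.orient]
    · rw [(gluable_stack x y).mem_ends, mem_ends_stack]
      rcases p with i | k <;> simp [SignSeq.orient]
  not_inner := by
    intro h c hc hi
    obtain ⟨d, hd, hdi⟩ := (gluable_stack x y).hasInnerEnd.1 ⟨c, hc, hi⟩
    rcases Multiset.mem_add.1 hd with hd | hd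
    · obtain ⟨d, hd', rfl⟩ := Multiset.mem_map.1 hd
      rw [hasInnerEnd_relabel] at hdi
      exact x.not_inner h d hd' hdi
    · obtain ⟨d, hd', rfl⟩ := Multiset.mem_map.1 hd
      rw [hasInnerEnd_relabel] at hdi
      exact y.not_inner h d hd' hdi

theorem id_comp {X Y : SignSeq} (x : Cobordism S inner X Y) : comp (id X) x = x := by
  ext1
  refine glue_eq sumMap_inr_injective (linear_stack _ _) ?_
  have := reduces_plainArc (Z := (Set.range (Sum.map _root_.id Sum.inr :
      X.Pt ⊕ Y.Pt → X.Pt ⊕ (X.Pt ⊕ Y.Pt)))ᶜ) x.boundary Sum.inr (Sum.map _root_.id Sum.inr)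
    (Finset.univ.map ⟨Sum.inl, Sum.inl_injective⟩) (by
      rintro p hp
      obtain ⟨i, -, rfl⟩ := Finset.mem_map.1 hp
      rintro ⟨q, hq⟩
      rcases q with q | q <;> simp at hq)
  convert this using 1
  unfold stack
  congr 1
  · simp only [id, Diagram.relabel, Multiset.map_map, Finset.map_val]
    refine Multiset.map_congr rfl fun i _ => ?_
    simp [relabel_plainArc, SignSeq.orient]
  · congr 1
    funext p
    rcases p with p | p <;> simp

theorem comp_id {X Y : SignSeq} (x : Cobordism S inner X Y) : comp x (id Y) = x := by
  ext1
  refine glue_eq sumMap_inr_injective (linear_stack _ _) ?_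
  have := reduces_plainArc (Z := (Set.range (Sum.map _root_.id Sum.inr :
      X.Pt ⊕ Y.Pt → X.Pt ⊕ (Y.Pt ⊕ Y.Pt)))ᶜ) x.boundary (Sum.map _root_.id Sum.inl)
    (Sum.map _root_.id Sum.inr)
    (Finset.univ.map ⟨Sum.inr, Sum.inr_injective⟩) (by
      rintro p hp
      obtain ⟨i, -, rfl⟩ := Finset.mem_map.1 hp
      rintro ⟨q, hq⟩
      rcases q with q | q <;> simp at hq)
  convert this using 1
  unfold stack
  rw [add_comm]
  congr 1
  · simp only [id, Diagram.relabel, Multiset.map_map, Finset.map_val]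
    refine Multiset.map_congr rfl fun i _ => ?_
    simp [relabel_plainArc, SignSeq.orient, plainArc_not]
  · congr 1
    funext p
    rcases p with p | p <;> simp

theorem reduces_comp {X Y Z : SignSeq} (x : Cobordism S inner X Y)
    (y : Cobordism S inner Y Z) {Q : Type} (f : X.Pt ⊕ (Y.Pt ⊕ Z.Pt) → Q) {W : Set Q}
    (hf : ∀ j, f (Sum.inr (Sum.inl j)) ∈ W) :
    Reduces W (x.comps.relabel (f ∘ Sum.map _root_.id Sum.inl) + y.comps.relabel (f ∘ Sum.inr))
      ((comp x y).comps.relabel (f ∘ Sum.map _root_.id Sum.inr)) := by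
  have := (gluable_stack x y).reduces.relabel f (Z' := W) (by
    rintro (i | j | k) hp
    · exact absurd ⟨Sum.inl i, rfl⟩ hp
    · exact hf j
    · exact absurd ⟨Sum.inr k, rfl⟩ hp)
  rw [stack, relabel_add, relabel_relabel, relabel_relabel, relabel_relabel] at this
  exact this

theorem linear_triple {X Y Z W : SignSeq} (x : Cobordism S inner X Y)
    (y : Cobordism S inner Y Z) (z : Cobordism S inner Z W) :
    Linear (x.comps.relabel (Sum.map _root_.id Sum.inl : X.Pt ⊕ Y.Pt →
        X.Pt ⊕ (Y.Pt ⊕ (Z.Pt ⊕ W.Pt))) +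
      y.comps.relabel (Sum.inr ∘ Sum.map _root_.id Sum.inl) +
      z.comps.relabel (Sum.inr ∘ Sum.inr)) := by
  have h : (x.comps.relabel (Sum.map _root_.id Sum.inl : X.Pt ⊕ Y.Pt →
        X.Pt ⊕ (Y.Pt ⊕ (Z.Pt ⊕ W.Pt))) +
      y.comps.relabel (Sum.inr ∘ Sum.map _root_.id Sum.inl)) =
      (stack x y).relabel (Sum.map _root_.id (Sum.map _root_.id Sum.inl)) := by
    rw [stack, relabel_add, relabel_relabel, relabel_relabel]
    congr 2
    funext p; rcases p with p | p <;> rfl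
  rw [h]
  refine linear_add_relabel (linear_stack x y) z.boundary.linear
    (Function.injective_id.sumMap sumMap_inl_injective)
    (Sum.inr_injective.comp Sum.inr_injective) ?_
  intro p q hpq
  rw [mem_starts_stack, mem_ends_stack, z.boundary.mem_starts, z.boundary.mem_ends]
  rcases p with p | p | p <;> rcases q with q | q <;> simp at hpq
  subst hpq
  simp [SignSeq.orient]

theorem comp_assoc {X Y Z W : SignSeq} (x : Cobordism S inner X Y)
    (y : Cobordism S inner Y Z) (z : Cobordism S inner Z W) :
    comp (comp x y) z = comp x (comp y z) := by
  let T := X.Pt ⊕ (Y.Pt ⊕ (Z.Pt ⊕ W.Pt))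
  let fx : X.Pt ⊕ Y.Pt → T := Sum.map _root_.id Sum.inl
  let fy : Y.Pt ⊕ Z.Pt → T := Sum.inr ∘ Sum.map _root_.id Sum.inl
  let fz : Z.Pt ⊕ W.Pt → T := Sum.inr ∘ Sum.inr
  let e : X.Pt ⊕ W.Pt → T := Sum.map _root_.id (Sum.inr ∘ Sum.inr)
  have he : e.Injective :=
    Function.injective_id.sumMap (Sum.inr_injective.comp Sum.inr_injective)
  let m : Diagram S T := x.comps.relabel fx + y.comps.relabel fy + z.comps.relabel fz
  have hm : Linear m := linear_triple x y z
  have hY : ∀ j : Y.Pt, (Sum.inr (Sum.inl j) : T) ∈ (Set.range e)ᶜ := by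
    rintro j ⟨q | q, hq⟩ <;> cases hq
  have hZ : ∀ j : Z.Pt, (Sum.inr (Sum.inr (Sum.inl j)) : T) ∈ (Set.range e)ᶜ := by
    rintro j ⟨q | q, hq⟩ <;> cases hq
  have e1 : (Sum.map _root_.id (Sum.map _root_.id Sum.inl) : X.Pt ⊕ (Y.Pt ⊕ Z.Pt) → T) ∘
      Sum.map _root_.id Sum.inl = fx := by
    funext p; rcases p with p | p <;> rfl
  have e2 : (Sum.map _root_.id (Sum.map _root_.id Sum.inl) : X.Pt ⊕ (Y.Pt ⊕ Z.Pt) → T) ∘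
      Sum.map _root_.id Sum.inr = (Sum.map _root_.id Sum.inr : X.Pt ⊕ (Z.Pt ⊕ W.Pt) → T) ∘
      Sum.map _root_.id Sum.inl := by
    funext p; rcases p with p | p <;> rfl
  have e3 : (Sum.map _root_.id Sum.inr : X.Pt ⊕ (Z.Pt ⊕ W.Pt) → T) ∘
      Sum.map _root_.id Sum.inr = e := by
    funext p; rcases p with p | p <;> rfl
  have e4 : (Sum.map _root_.id (Sum.map _root_.id Sum.inr) : X.Pt ⊕ (Y.Pt ⊕ W.Pt) → T) ∘
      Sum.map _root_.id Sum.inl = fx := by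
    funext p; rcases p with p | p <;> rfl
  have e5 : (Sum.map _root_.id (Sum.map _root_.id Sum.inr) : X.Pt ⊕ (Y.Pt ⊕ W.Pt) → T) ∘
      Sum.map _root_.id Sum.inr = e := by
    funext p; rcases p with p | p <;> rfl
  have h1 : Reduces (Set.range e)ᶜ m ((comp (comp x y) z).comps.relabel e) := by
    have a := (reduces_comp x y (W := (Set.range e)ᶜ)
      (Sum.map _root_.id (Sum.map _root_.id Sum.inl) : X.Pt ⊕ (Y.Pt ⊕ Z.Pt) → T) hY).add_right
      (z.comps.relabel fz)
    have b := reduces_comp (comp x y) z (W := (Set.range e)ᶜ)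
      (Sum.map _root_.id Sum.inr : X.Pt ⊕ (Z.Pt ⊕ W.Pt) → T) hZ
    rw [e1, e2] at a
    rw [e3] at b
    exact a.trans b
  have h2 : Reduces (Set.range e)ᶜ m ((comp x (comp y z)).comps.relabel e) := by
    have a := (reduces_comp y z (W := (Set.range e)ᶜ)
      (Sum.inr : Y.Pt ⊕ (Z.Pt ⊕ W.Pt) → T) hZ).add_left (x.comps.relabel fx)
    have b := reduces_comp x (comp y z) (W := (Set.range e)ᶜ)
      (Sum.map _root_.id (Sum.map _root_.id Sum.inr) : X.Pt ⊕ (Y.Pt ⊕ W.Pt) → T) hY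
    rw [e4, e5] at b
    rw [← add_assoc] at a
    exact a.trans b
  ext1
  rw [← glue_eq he hm h1, ← glue_eq he hm h2]

end Cobordism

/-- The category of `S`-decorated one-dimensional cobordisms between sign sequences. Inner
(floating) endpoints are allowed if `inner = true` and forbidden if `inner = false`. -/
@[ext] structure Cob (S : Type u) (inner : Bool) : Type where
  obj : SignSeq

noncomputable instance (S : Type u) (inner : Bool) : CategoryTheory.Category (Cob S inner) where
  Hom X Y := Cobordism S inner X.obj Y.obj
  id X := Cobordism.id X.obj
  comp x y := Cobordism.comp x y
  id_comp := Cobordism.id_comp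
  comp_id := Cobordism.comp_id
  assoc := Cobordism.comp_assoc

/-- The inclusion of the category of cobordisms without inner endpoints into the category of
cobordisms with inner endpoints. -/
noncomputable def Cob.incl (S : Type u) : CategoryTheory.Functor (Cob S false) (Cob S true) where
  obj X := ⟨X.obj⟩
  map x := ⟨x.comps, x.boundary, nofun⟩


open Relation Diagram Component

namespace Cobordism

variable {S : Type u} {T : Type v} {inner : Bool}

/-- Replace each dot of a cobordism by a word of dots. -/
def subst {X Y : SignSeq} (φ : S → List T) (x : Cobordism S inner X Y) :
    Cobordism T inner X Y where
  comps := x.comps.subst φ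
  boundary := ⟨by simpa [Diagram.Linear] using x.boundary.linear,
    by simpa using x.boundary.mem_starts, by simpa using x.boundary.mem_ends⟩
  not_inner := by
    intro h c hc
    obtain ⟨d, hd, rfl⟩ := Multiset.mem_map.1 hc
    rw [hasInnerEnd_subst]
    exact x.not_inner h d hd

theorem subst_comp {X Y Z : SignSeq} (φ : S → List T) (x : Cobordism S inner X Y)
    (y : Cobordism S inner Y Z) : subst φ (comp x y) = comp (subst φ x) (subst φ y) := by
  ext1
  show Diagram.subst φ (glue _ (stack x y)) = glue _ (stack (subst φ x) (subst φ y))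
  rw [← (gluable_stack x y).subst φ, stack, subst_add, subst_relabel, subst_relabel]
  rfl

/-- The closure of an endomorphism of a sign sequence: each top point is joined to the
corresponding bottom point, which gives a floating diagram (without boundary). -/
noncomputable def closure {X : SignSeq} (x : Cobordism S inner X X) : Diagram S Empty :=
  glue (Empty.elim : Empty → X.Pt) (x.comps.relabel (Sum.elim _root_.id _root_.id))

theorem gluable_closure {X : SignSeq} (x : Cobordism S inner X X) :
    Gluable (Empty.elim : Empty → X.Pt) (x.comps.relabel (Sum.elim _root_.id _root_.id)) := by
  have hs := x.boundary.mem_starts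
  have he := x.boundary.mem_ends
  refine ⟨fun a => a.elim, ⟨?_, ?_⟩, fun p _ => ?_⟩
  · rw [starts_relabel]
    refine Multiset.Nodup.map_on ?_ x.boundary.linear.1
    rintro (p | p) hp (q | q) hq <;> simp_all [SignSeq.orient]
    · rintro rfl; simp_all
    · rintro rfl; simp_all
  · rw [ends_relabel]
    refine Multiset.Nodup.map_on ?_ x.boundary.linear.2
    rintro (p | p) hp (q | q) hq <;> simp_all [SignSeq.orient]
    · rintro rfl; simp_all
    · rintro rfl; simp_all
  · simp [hs, he, SignSeq.orient, or_comm]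

theorem closure_subst {X : SignSeq} (φ : S → List T) (x : Cobordism S inner X X) :
    (subst φ x).closure = x.closure.subst φ := by
  rw [closure, closure, ← (gluable_closure x).subst φ, subst_relabel]
  rfl

theorem closure_comp_comm {X Y : SignSeq} (x : Cobordism S inner X Y)
    (y : Cobordism S inner Y X) : (comp x y).closure = (comp y x).closure := by
  let m : Diagram S (X.Pt ⊕ Y.Pt) := x.comps + y.comps.relabel Sum.swap
  have hm : Linear m := by
    have := linear_add_relabel (R := X.Pt ⊕ Y.Pt) x.boundary.linear y.boundary.linear
      (f := _root_.id) (g := Sum.swap) Function.injective_id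
      (Function.LeftInverse.injective Sum.swap_swap) (by
        rintro p q hpq
        rw [x.boundary.mem_starts, x.boundary.mem_ends, y.boundary.mem_starts,
          y.boundary.mem_ends]
        rcases p with p | p <;> rcases q with q | q <;> simp at hpq <;> subst hpq <;>
          simp [SignSeq.orient])
    rwa [relabel_id] at this
  have e : ∀ p : X.Pt ⊕ Y.Pt,
      p ∈ (Set.range (Empty.elim : Empty → X.Pt ⊕ Y.Pt))ᶜ := by
    rintro p ⟨a, -⟩; exact a.elim
  have h1 : Reduces (Set.range (Empty.elim : Empty → X.Pt ⊕ Y.Pt))ᶜ m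
      ((comp x y).closure.relabel Empty.elim) := by
    have a := reduces_comp x y (W := (Set.range (Empty.elim : Empty → X.Pt ⊕ Y.Pt))ᶜ)
      (Sum.elim Sum.inl (Sum.elim Sum.inr Sum.inl)) (fun j => e _)
    have b := (gluable_closure (comp x y)).reduces.relabel (Sum.inl : X.Pt → X.Pt ⊕ Y.Pt)
      (Z' := (Set.range (Empty.elim : Empty → X.Pt ⊕ Y.Pt))ᶜ) (fun p _ => e _)
    rw [relabel_relabel, relabel_relabel] at b
    have e1 : (Sum.elim Sum.inl (Sum.elim Sum.inr Sum.inl) :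
        X.Pt ⊕ (Y.Pt ⊕ X.Pt) → X.Pt ⊕ Y.Pt) ∘ Sum.map _root_.id Sum.inl = _root_.id := by
      funext p; rcases p with p | p <;> rfl
    have e2 : (Sum.elim Sum.inl (Sum.elim Sum.inr Sum.inl) :
        X.Pt ⊕ (Y.Pt ⊕ X.Pt) → X.Pt ⊕ Y.Pt) ∘ Sum.inr = Sum.swap := by
      funext p; rcases p with p | p <;> rfl
    have e3 : (Sum.elim Sum.inl (Sum.elim Sum.inr Sum.inl) :
        X.Pt ⊕ (Y.Pt ⊕ X.Pt) → X.Pt ⊕ Y.Pt) ∘ Sum.map _root_.id Sum.inr =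
        Sum.inl ∘ Sum.elim _root_.id _root_.id := by
      funext p; rcases p with p | p <;> rfl
    have e4 : (Sum.inl : X.Pt → X.Pt ⊕ Y.Pt) ∘ Empty.elim = Empty.elim := by
      funext p; exact p.elim
    rw [e1, e2, e3, relabel_id] at a
    rw [e4] at b
    exact a.trans b
  have h2 : Reduces (Set.range (Empty.elim : Empty → X.Pt ⊕ Y.Pt))ᶜ m
      ((comp y x).closure.relabel Empty.elim) := by
    have a := reduces_comp y x (W := (Set.range (Empty.elim : Empty → X.Pt ⊕ Y.Pt))ᶜ)
      (Sum.elim Sum.inr (Sum.elim Sum.inl Sum.inr)) (fun j => e _)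
    have b := (gluable_closure (comp y x)).reduces.relabel (Sum.inr : Y.Pt → X.Pt ⊕ Y.Pt)
      (Z' := (Set.range (Empty.elim : Empty → X.Pt ⊕ Y.Pt))ᶜ) (fun p _ => e _)
    rw [relabel_relabel, relabel_relabel] at b
    have e1 : (Sum.elim Sum.inr (Sum.elim Sum.inl Sum.inr) :
        Y.Pt ⊕ (X.Pt ⊕ Y.Pt) → X.Pt ⊕ Y.Pt) ∘ Sum.map _root_.id Sum.inl = Sum.swap := by
      funext p; rcases p with p | p <;> rfl
    have e2 : (Sum.elim Sum.inr (Sum.elim Sum.inl Sum.inr) :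
        Y.Pt ⊕ (X.Pt ⊕ Y.Pt) → X.Pt ⊕ Y.Pt) ∘ Sum.inr = _root_.id := by
      funext p; rcases p with p | p <;> rfl
    have e3 : (Sum.elim Sum.inr (Sum.elim Sum.inl Sum.inr) :
        Y.Pt ⊕ (X.Pt ⊕ Y.Pt) → X.Pt ⊕ Y.Pt) ∘ Sum.map _root_.id Sum.inr =
        Sum.inr ∘ Sum.elim _root_.id _root_.id := by
      funext p; rcases p with p | p <;> rfl
    have e4 : (Sum.inr : Y.Pt → X.Pt ⊕ Y.Pt) ∘ Empty.elim = Empty.elim := by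
      funext p; exact p.elim
    rw [e1, e2, e3, relabel_id, add_comm] at a
    rw [e4] at b
    exact a.trans b
  have hi : (Empty.elim : Empty → X.Pt ⊕ Y.Pt).Injective := fun a => a.elim
  rw [← glue_eq hi hm h1, ← glue_eq hi hm h2]

end Cobordism


open Relation Diagram Component

variable {S : Type u} {T : Type v} {P Q : Type}

/-! Placing words at a marked dot. -/

/-- The number of occurrences of the marked dot `none`. -/
def Component.marks : Component (Option S) P → ℕ
  | arc _ w _ => (w : Multiset (Option S)).countP fun t => t.isNone
  | circle c => c.toMultiset.countP fun t => t.isNone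

/-- The number of occurrences of the marked dot `none` in a diagram. -/
def Diagram.marks (m : Diagram (Option S) P) : ℕ := (m.map Component.marks).sum

/-- Replace the marked dot by the word `t` and keep the other dots. -/
def fill (t : List S) : Option S → List S
  | none => t
  | some s => [s]

/-- Some interval begins at an inner endpoint directly followed by the marked dot. -/
def Diagram.MarkedStart (m : Diagram (Option S) P) : Prop :=
  ∃ (w : List (Option S)) (b : Option P), arc none (w ++ [none]) b ∈ m

/-- Some interval ends at an inner endpoint directly preceded by the marked dot. -/
def Diagram.MarkedEnd (m : Diagram (Option S) P) : Prop :=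
  ∃ (a : Option P) (w : List (Option S)), arc a (none :: w) none ∈ m

theorem Component.marks_relabel (f : P → Q) (c : Component (Option S) P) :
    (c.relabel f).marks = c.marks := by
  cases c <;> rfl

theorem Diagram.marks_relabel (f : P → Q) (m : Diagram (Option S) P) :
    (m.relabel f).marks = m.marks := by
  unfold Diagram.marks Diagram.relabel
  rw [Multiset.map_map]
  congr 1
  exact Multiset.map_congr rfl fun c _ => Component.marks_relabel f c

theorem Diagram.marks_add (m n : Diagram (Option S) P) :
    (m + n).marks = m.marks + n.marks := by
  simp [Diagram.marks]

theorem Diagram.Step.marks_eq {Z : Set P} {m m' : Diagram (Option S) P} (h : Step Z m m') :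
    m'.marks = m.marks := by
  cases h with
  | join p hp a b u v r =>
    simp [Diagram.marks, Component.marks, List.countP_append]; omega
  | close p hp u r =>
    simp [Diagram.marks, Component.marks]

theorem Diagram.Reduces.marks_eq {Z : Set P} {m m' : Diagram (Option S) P} (h : Reduces Z m m') :
    m'.marks = m.marks := by
  induction h with
  | refl => rfl
  | tail _ h ih => rw [h.marks_eq, ih]

theorem Diagram.Step.markedStart {Z : Set P} {m m' : Diagram (Option S) P} (h : Step Z m m')
    (hm : m.MarkedStart) : m'.MarkedStart := by
  obtain ⟨w, c, hw⟩ := hm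
  cases h with
  | join p hp a b u v r =>
    rcases Multiset.mem_cons.1 hw with h | h
    · simp only [arc.injEq] at h
      obtain ⟨rfl, rfl, rfl⟩ := h
      exact ⟨v ++ w, b, by simp⟩
    · rcases Multiset.mem_cons.1 h with h | h
      · simp at h
      · exact ⟨w, c, Multiset.mem_cons_of_mem h⟩
  | close p hp u r =>
    rcases Multiset.mem_cons.1 hw with h | h
    · simp at h
    · exact ⟨w, c, Multiset.mem_cons_of_mem h⟩

theorem Diagram.Reduces.markedStart {Z : Set P} {m m' : Diagram (Option S) P}
    (h : Reduces Z m m') (hm : m.MarkedStart) : m'.MarkedStart := by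
  induction h with
  | refl => exact hm
  | tail _ h ih => exact h.markedStart ih

theorem Diagram.Step.markedEnd {Z : Set P} {m m' : Diagram (Option S) P} (h : Step Z m m')
    (hm : m.MarkedEnd) : m'.MarkedEnd := by
  obtain ⟨c, w, hw⟩ := hm
  cases h with
  | join p hp a b u v r =>
    rcases Multiset.mem_cons.1 hw with h | h
    · simp at h
    · rcases Multiset.mem_cons.1 h with h | h
      · simp only [arc.injEq] at h
        obtain ⟨rfl, rfl, rfl⟩ := h
        exact ⟨a, w ++ u, by simp⟩
      · exact ⟨c, w, Multiset.mem_cons_of_mem h⟩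
  | close p hp u r =>
    rcases Multiset.mem_cons.1 hw with h | h
    · simp at h
    · exact ⟨c, w, Multiset.mem_cons_of_mem h⟩

theorem Diagram.Reduces.markedEnd {Z : Set P} {m m' : Diagram (Option S) P}
    (h : Reduces Z m m') (hm : m.MarkedEnd) : m'.MarkedEnd := by
  induction h with
  | refl => exact hm
  | tail _ h ih => exact h.markedEnd ih

theorem Diagram.markedStart_relabel {f : P → Q} (m : Diagram (Option S) P) :
    (m.relabel f).MarkedStart ↔ m.MarkedStart := by
  constructor
  · rintro ⟨w, b, h⟩
    obtain ⟨c, hc, e⟩ := Multiset.mem_map.1 h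
    rcases c with ⟨a', w', b'⟩ | c
    · simp only [Component.relabel, arc.injEq, Option.map_eq_none_iff] at e
      obtain ⟨rfl, rfl, -⟩ := e
      exact ⟨w, b', hc⟩
    · simp [Component.relabel] at e
  · rintro ⟨w, b, h⟩
    exact ⟨w, b.map f, Multiset.mem_map.2 ⟨_, h, rfl⟩⟩

theorem Diagram.markedEnd_relabel {f : P → Q} (m : Diagram (Option S) P) :
    (m.relabel f).MarkedEnd ↔ m.MarkedEnd := by
  constructor
  · rintro ⟨a, w, h⟩
    obtain ⟨c, hc, e⟩ := Multiset.mem_map.1 h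
    rcases c with ⟨a', w', b'⟩ | c
    · simp only [Component.relabel, arc.injEq, Option.map_eq_none_iff] at e
      obtain ⟨-, rfl, rfl⟩ := e
      exact ⟨a', w, hc⟩
    · simp [Component.relabel] at e
  · rintro ⟨a, w, h⟩
    exact ⟨a.map f, w, Multiset.mem_map.2 ⟨_, h, rfl⟩⟩

namespace Cobordism

variable {inner : Bool}

/-- A cobordism regarded as a cobordism decorated by unmarked dots. -/
def lift {X Y : SignSeq} (x : Cobordism S inner X Y) : Cobordism (Option S) inner X Y :=
  x.subst fun s => [some s]

theorem flatMap_fill (t w : List S) :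
    (w.flatMap fun s => [some s]).flatMap (fill t) = w := by
  induction w with
  | nil => rfl
  | cons s w ih => simp_all [fill]

theorem subst_fill_lift {X Y : SignSeq} (t : List S) (x : Cobordism S inner X Y) :
    x.lift.subst (fill t) = x := by
  ext1
  show (x.comps.map _).map _ = x.comps
  rw [Multiset.map_map]
  conv_rhs => rw [← Multiset.map_id x.comps]
  refine Multiset.map_congr rfl fun c _ => ?_
  rcases c with ⟨a, w, b⟩ | c
  · simp [Component.subst, flatMap_fill]
  · induction c using Quotient.inductionOn' with
    | h w =>
      show circle (((w.flatMap fun s => [some s]).flatMap (fill t) : List S) : Cycle S) = _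
      rw [flatMap_fill]; rfl

theorem marks_lift {X Y : SignSeq} (x : Cobordism S inner X Y) : x.lift.comps.marks = 0 := by
  show ((x.comps.map _).map _).sum = 0
  rw [Multiset.map_map]
  refine Multiset.sum_eq_zero fun n hn => ?_
  obtain ⟨c, -, rfl⟩ := Multiset.mem_map.1 hn
  rcases c with ⟨a, w, b⟩ | c
  · rw [Function.comp, Component.subst, Component.marks, Multiset.countP_eq_zero]
    simp
    rintro a x - rfl
    simp
  · induction c using Quotient.inductionOn' with
    | h w =>
      show Multiset.countP (fun t : Option S => t.isNone = true)
        ((w.flatMap fun s => [some s] : List (Option S)) : Multiset (Option S)) = 0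
      rw [Multiset.countP_eq_zero]
      simp
      rintro a x - rfl
      simp

theorem reduces_stack {X Y Z : SignSeq} (x : Cobordism S inner X Y)
    (y : Cobordism S inner Y Z) :
    Reduces (Set.range (Sum.map _root_.id Sum.inr : X.Pt ⊕ Z.Pt → X.Pt ⊕ (Y.Pt ⊕ Z.Pt)))ᶜ
      (stack x y) ((comp x y).comps.relabel (Sum.map _root_.id Sum.inr)) :=
  (gluable_stack x y).reduces

theorem marks_comp {X Y Z : SignSeq} (x : Cobordism (Option S) inner X Y)
    (y : Cobordism (Option S) inner Y Z) :
    (comp x y).comps.marks = x.comps.marks + y.comps.marks := by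
  have := (reduces_stack x y).marks_eq
  rwa [Diagram.marks_relabel, stack, marks_add, Diagram.marks_relabel,
    Diagram.marks_relabel] at this

theorem markedStart_comp {X Y Z : SignSeq} (x : Cobordism (Option S) inner X Y)
    (y : Cobordism (Option S) inner Y Z)
    (h : x.comps.MarkedStart ∨ y.comps.MarkedStart) : (comp x y).comps.MarkedStart := by
  refine (markedStart_relabel _).1 ((reduces_stack x y).markedStart ?_)
  rcases h with h | h <;> obtain ⟨w, b, h⟩ := (markedStart_relabel _).2 h
  · exact ⟨w, b, Multiset.mem_add.2 (Or.inl h)⟩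
  · exact ⟨w, b, Multiset.mem_add.2 (Or.inr h)⟩

theorem markedEnd_comp {X Y Z : SignSeq} (x : Cobordism (Option S) inner X Y)
    (y : Cobordism (Option S) inner Y Z)
    (h : x.comps.MarkedEnd ∨ y.comps.MarkedEnd) : (comp x y).comps.MarkedEnd := by
  refine (markedEnd_relabel _).1 ((reduces_stack x y).markedEnd ?_)
  rcases h with h | h <;> obtain ⟨a, w, h⟩ := (markedEnd_relabel _).2 h
  · exact ⟨a, w, Multiset.mem_add.2 (Or.inl h)⟩
  · exact ⟨a, w, Multiset.mem_add.2 (Or.inr h)⟩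

/-- Adding a floating component commutes with composition. -/
theorem comps_comp_left {X Y Z : SignSeq} {x x' : Cobordism S inner X Y} (c : ∀ P, Component S P)
    (hc : ∀ {P Q : Type} (f : P → Q), (c P).relabel f = c Q)
    (h : x'.comps = c _ ::ₘ x.comps) (y : Cobordism S inner Y Z) :
    (comp x' y).comps = c _ ::ₘ (comp x y).comps := by
  refine glue_eq sumMap_inr_injective (linear_stack _ _) ?_
  have e : stack x' y = {c _} + stack x y := by
    rw [stack, h, relabel_cons, hc, stack]; simp
  rw [e, relabel_cons, hc, ← Multiset.singleton_add]
  exact (reduces_stack x y).add_left _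

theorem comps_comp_right {X Y Z : SignSeq} (x : Cobordism S inner X Y)
    {y y' : Cobordism S inner Y Z} (c : ∀ P, Component S P)
    (hc : ∀ {P Q : Type} (f : P → Q), (c P).relabel f = c Q)
    (h : y'.comps = c _ ::ₘ y.comps) :
    (comp x y').comps = c _ ::ₘ (comp x y).comps := by
  refine glue_eq sumMap_inr_injective (linear_stack _ _) ?_
  have e : stack x y' = {c _} + stack x y := by
    rw [stack, h, relabel_cons, hc, stack]; simp
  rw [e, relabel_cons, hc, ← Multiset.singleton_add]
  exact (reduces_stack x y).add_left _

end Cobordism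


open Idempotents

section Linear

variable {k : Type u} [Field k] {C : Type v} [Category.{w} C] [Preadditive C]
  [CategoryTheory.Linear k C]

/-! The matrix category and the Karoubi envelope of a `k`-linear category are `k`-linear. -/

instance (M N : Mat_ C) : SMul k (M ⟶ N) := ⟨fun r f i j => r • f i j⟩

theorem Mat.smul_apply {M N : Mat_ C} (r : k) (f : M ⟶ N) (i : M.ι) (j : N.ι) :
    (r • f) i j = r • f i j := rfl

instance (M N : Mat_ C) : Module k (M ⟶ N) where
  one_smul f := by ext i j; exact one_smul k (f i j)
  mul_smul r s f := by ext i j; exact mul_smul r s (f i j)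
  smul_zero r := by ext i j; exact smul_zero (A := (M.X i ⟶ N.X j)) r
  smul_add r f g := by ext i j; exact smul_add r (f i j) (g i j)
  add_smul r s f := by ext i j; exact add_smul r s (f i j)
  zero_smul f := by ext i j; exact zero_smul k (f i j)

instance : CategoryTheory.Linear k (Mat_ C) where
  smul_comp M N K r f g := by
    ext i j
    simp [Mat.smul_apply, Finset.smul_sum]
  comp_smul M N K f r g := by
    ext i j
    simp [Mat.smul_apply, Finset.smul_sum]

instance (P Q : Karoubi C) : SMul k (P ⟶ Q) := ⟨fun r f => ⟨r • f.f, by simp⟩⟩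

theorem Kar.smul_f {P Q : Karoubi C} (r : k) (f : P ⟶ Q) : (r • f).f = r • f.f := rfl

instance (P Q : Karoubi C) : Module k (P ⟶ Q) :=
  Function.Injective.module k (Karoubi.inclusionHom P Q) (fun _ _ h => Karoubi.hom_ext _ _ h)
    (fun _ _ => rfl)

instance : CategoryTheory.Linear k (Karoubi C) where
  smul_comp P Q R r f g := by ext; simp [Kar.smul_f]
  comp_smul P Q R f r g := by ext; simp [Kar.smul_f]

variable (k C) in
/-- A two-sided ideal of a `k`-linear category. -/
structure HomIdeal where
  carrier : ∀ X Y : C, Submodule k (X ⟶ Y)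
  comp_left : ∀ {X Y Z : C} (f : X ⟶ Y) {g : Y ⟶ Z}, g ∈ carrier Y Z → f ≫ g ∈ carrier X Z
  comp_right : ∀ {X Y Z : C} {f : X ⟶ Y} (g : Y ⟶ Z), f ∈ carrier X Y → f ≫ g ∈ carrier X Z

namespace HomIdeal

variable (I : HomIdeal k C)

/-- Congruence modulo the ideal. -/
def rel : HomRel C := fun X Y f g => f - g ∈ I.carrier X Y

instance : Congruence I.rel where
  comp_left f g g' h := by
    show f ≫ g - f ≫ g' ∈ _
    rw [← Preadditive.comp_sub]
    exact I.comp_left f h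
  comp_right {_ _ _ f f'} g h := by
    show f ≫ g - f' ≫ g ∈ _
    rw [← Preadditive.sub_comp]
    exact I.comp_right g h
  equivalence {X Y} :=
    { refl := fun f => by
        show f - f ∈ _
        rw [sub_self]; exact zero_mem _
      symm := fun {f g} h => by
        show g - f ∈ _
        rw [← neg_sub]; exact neg_mem h
      trans := fun {f g h} hfg hgh => by
        show f - h ∈ _
        rw [← sub_add_sub_cancel f g h]; exact add_mem hfg hgh }

/-- The quotient of the category by the ideal. -/
abbrev Quot : Type v := CategoryTheory.Quotient I.rel

theorem rel_add ⦃X Y : C⦄ (f₁ f₂ g₁ g₂ : X ⟶ Y) (hf : I.rel f₁ f₂) (hg : I.rel g₁ g₂) :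
    I.rel (f₁ + g₁) (f₂ + g₂) := by
  show f₁ + g₁ - (f₂ + g₂) ∈ _
  rw [add_sub_add_comm]
  exact add_mem hf hg

theorem rel_smul (r : k) ⦃X Y : C⦄ (f₁ f₂ : X ⟶ Y) (hf : I.rel f₁ f₂) :
    I.rel (r • f₁) (r • f₂) := by
  show r • f₁ - r • f₂ ∈ _
  rw [← smul_sub]
  exact Submodule.smul_mem _ _ hf

instance : Preadditive I.Quot := Quotient.preadditive I.rel I.rel_add

instance : (Quotient.functor I.rel).Additive := Quotient.functor_additive I.rel I.rel_add

instance : CategoryTheory.Linear k I.Quot := Quotient.linear k I.rel I.rel_smul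

instance : (Quotient.functor I.rel).Linear k := Quotient.linear_functor k I.rel I.rel_smul

/-- The quotient functor. -/
abbrev proj : C ⥤ I.Quot := Quotient.functor I.rel

theorem proj_eq_zero_iff {X Y : C} (f : X ⟶ Y) : I.proj.map f = 0 ↔ f ∈ I.carrier X Y := by
  rw [← I.proj.map_zero, Quotient.functor_map_eq_iff]
  show f - 0 ∈ _ ↔ _
  rw [sub_zero]

end HomIdeal

variable (k C) in
/-- A symmetric trace on a `k`-linear category. -/
structure TraceForm where
  tr : ∀ X : C, (X ⟶ X) →ₗ[k] k
  comm : ∀ {X Y : C} (f : X ⟶ Y) (g : Y ⟶ X), tr X (f ≫ g) = tr Y (g ≫ f)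

namespace TraceForm

variable (t : TraceForm k C)

/-- The trace induced on the quotient by an ideal on which the trace vanishes. -/
def ofQuot (I : HomIdeal k C) (h : ∀ (X : C) (f : X ⟶ X), f ∈ I.carrier X X → t.tr X f = 0) :
    TraceForm k I.Quot where
  tr X :=
    { toFun := _root_.Quot.lift (fun f => t.tr X.as f) (by
        intro f g hfg
        rw [HomRel.compClosure_eq_self] at hfg
        have := h _ _ hfg
        rwa [map_sub, sub_eq_zero] at this)
      map_add' := by
        rintro ⟨f⟩ ⟨g⟩
        exact map_add (t.tr X.as) f g
      map_smul' := by
        rintro r ⟨f⟩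
        exact map_smul (t.tr X.as) r f }
  comm := by
    rintro X Y ⟨f⟩ ⟨g⟩
    exact t.comm f g

/-- The extension of the trace to formal finite direct sums: the sum of the traces of the diagonal
entries. -/
noncomputable def mat : TraceForm k (Mat_ C) where
  tr M :=
    { toFun := fun f => ∑ i, t.tr (M.X i) (f i i)
      map_add' := fun f g => by simp [Finset.sum_add_distrib]
      map_smul' := fun r f => by simp [Mat.smul_apply, Finset.mul_sum] }
  comm f g := by
    simp only [LinearMap.coe_mk, AddHom.coe_mk, Mat_.comp_apply, map_sum]
    rw [Finset.sum_comm]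
    simp only [t.comm]

/-- The extension of the trace to formal images of idempotents. -/
def kar : TraceForm k (Karoubi C) where
  tr P :=
    { toFun := fun f => t.tr P.X f.f
      map_add' := fun f g => map_add (t.tr P.X) f.f g.f
      map_smul' := fun r f => map_smul (t.tr P.X) r f.f }
  comm f g := t.comm f.f g.f

/-- The ideal of negligible morphisms. -/
def negligible : HomIdeal k C where
  carrier X Y :=
    { carrier := {f | ∀ z : Y ⟶ X, t.tr X (f ≫ z) = 0}
      add_mem' := fun {f g} hf hg z => by rw [Preadditive.add_comp, map_add, hf z, hg z, add_zero]
      zero_mem' := fun z => by simp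
      smul_mem' := fun r f hf z => by rw [Linear.smul_comp, map_smul, hf z, smul_zero] }
  comp_left f g hg z := by
    rw [Category.assoc, t.comm, Category.assoc]
    exact hg _
  comp_right g hf z := by
    rw [Category.assoc]
    exact hf _

/-- The quotient of the category by the negligible morphisms. -/
abbrev Gligible : Type v := t.negligible.Quot

/-- The quotient functor. -/
abbrev toGligible : C ⥤ t.Gligible := t.negligible.proj

end TraceForm

variable (C) in
/-- The additive Karoubi closure: formal finite direct sums, then formal images of idempotents. -/
noncomputable abbrev AddKar : Type _ := Karoubi (Mat_ C)

variable (C) in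
/-- The inclusion of a category in its additive Karoubi closure. -/
noncomputable abbrev toAddKar : C ⥤ AddKar C := Mat_.embedding C ⋙ toKaroubi (Mat_ C)

namespace TraceForm

variable (t : TraceForm k C)

/-- The extension of the trace to the additive Karoubi closure. -/
noncomputable abbrev addKar : TraceForm k (AddKar C) := t.mat.kar

theorem addKar_toAddKar {X : C} (f : X ⟶ X) :
    t.addKar.tr _ ((toAddKar C).map f) = t.tr X f := by
  show ∑ _i : PUnit, t.tr X f = t.tr X f
  simp

/-- The functor from the quotient of a category by negligible morphisms to the quotient of its
additive Karoubi closure by negligible morphisms, induced by the inclusion. -/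
noncomputable def gligibleToAddKar : t.Gligible ⥤ t.addKar.Gligible :=
  CategoryTheory.Quotient.lift _ (toAddKar C ⋙ t.addKar.toGligible) (by
    intro X Y f g h
    refine (Quotient.functor_map_eq_iff _ _ _).2 ?_
    show (toAddKar C).map f - (toAddKar C).map g ∈ _
    intro z
    obtain ⟨z, rfl⟩ := (toAddKar C).map_surjective z
    rw [← Functor.map_sub, ← Functor.map_comp, addKar_toAddKar]
    exact h z)

end TraceForm

end Linear


open Relation Diagram Component

/-! Noncommutative series and their syntactic ideals. -/

/-- Noncommutative polynomials in the letters `S`. -/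
abbrev NCPoly (k : Type u) [Field k] (S : Type v) : Type (max u v) :=
  MonoidAlgebra k (FreeMonoid S)

/-- Noncommutative formal power series in the letters `S`: functions on words. -/
abbrev Series (k : Type u) (S : Type v) : Type (max u v) := FreeMonoid S → k

namespace Series

variable {k : Type u} [Field k] {S : Type v}

/-- The linear functional on noncommutative polynomials given by a series. -/
noncomputable def eval (α : Series k S) : NCPoly k S →ₗ[k] k :=
  Finsupp.linearCombination k α ∘ₗ (MonoidAlgebra.coeffLinearEquiv k).toLinearMap

theorem eval_eq_sum (α : Series k S) (u : NCPoly k S) :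
    α.eval u = u.coeff.sum fun t a => a * α t := rfl

/-- The two-sided syntactic ideal. -/
def twoSidedIdeal (α : Series k S) : Set (NCPoly k S) := {u | ∀ v w, α.eval (v * u * w) = 0}

/-- The left syntactic ideal. -/
def leftIdeal (α : Series k S) : Set (NCPoly k S) := {u | ∀ v, α.eval (v * u) = 0}

/-- The right syntactic ideal. -/
def rightIdeal (α : Series k S) : Set (NCPoly k S) := {u | ∀ v, α.eval (u * v) = 0}

theorem eval_single_mul_mul_single (α : Series k S) (u : NCPoly k S) (w₁ w₂ : FreeMonoid S) :
    α.eval (MonoidAlgebra.single w₁ 1 * u * MonoidAlgebra.single w₂ 1) =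
      u.coeff.sum fun t a => a * α (w₁ * t * w₂) := by
  induction u using MonoidAlgebra.induction_linear with
  | zero => simp
  | add f g hf hg =>
    rw [mul_add, add_mul, map_add, hf, hg, MonoidAlgebra.coeff_add, Finsupp.sum_add_index'] <;>
      simp [add_mul]
  | single t a =>
    rw [MonoidAlgebra.single_mul_single, MonoidAlgebra.single_mul_single, eval_eq_sum,
      MonoidAlgebra.coeff_single, MonoidAlgebra.coeff_single, Finsupp.sum_single_index,
      Finsupp.sum_single_index] <;> simp

theorem sum_eq_zero_of_twoSided {α : Series k S} {u : NCPoly k S} (hu : u ∈ α.twoSidedIdeal)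
    (w₁ w₂ : FreeMonoid S) : (u.coeff.sum fun t a => a * α (w₁ * t * w₂)) = 0 := by
  rw [← eval_single_mul_mul_single]; exact hu _ _

theorem sum_eq_zero_of_left {α : Series k S} {u : NCPoly k S} (hu : u ∈ α.leftIdeal)
    (w₁ : FreeMonoid S) : (u.coeff.sum fun t a => a * α (w₁ * t)) = 0 := by
  have h := eval_single_mul_mul_single α u w₁ 1
  rw [← MonoidAlgebra.one_def, mul_one, hu] at h
  simpa using h.symm

theorem sum_eq_zero_of_right {α : Series k S} {u : NCPoly k S} (hu : u ∈ α.rightIdeal)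
    (w₂ : FreeMonoid S) : (u.coeff.sum fun t a => a * α (t * w₂)) = 0 := by
  have h := eval_single_mul_mul_single α u 1 w₂
  rw [← MonoidAlgebra.one_def, one_mul, hu] at h
  simpa using h.symm

end Series

/-- A symmetric series: its values are invariant under cyclic rotation of words. -/
structure SymmetricSeries (k : Type u) (S : Type v) : Type (max u v) where
  toSeries : Series k S
  symm : ∀ v w : FreeMonoid S, toSeries (v * w) = toSeries (w * v)

/-- The value of a symmetric series at a cyclic word. -/
def SymmetricSeries.onCycle {k : Type u} {S : Type v} (α : SymmetricSeries k S) : Cycle S → k :=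
  _root_.Quotient.lift (fun w : List S => α.toSeries (FreeMonoid.ofList w)) (by
    intro l l' h
    obtain ⟨n, hn, rfl⟩ := List.isRotated_iff_mod.1 h
    rw [List.rotate_eq_drop_append_take hn]
    conv_lhs => rw [← List.take_append_drop n l]
    exact α.symm (FreeMonoid.ofList (l.take n)) (FreeMonoid.ofList (l.drop n)))

/-- The data by which floating components are evaluated: a symmetric series for circles if inner
endpoints are forbidden, and a pair of a series for intervals and a symmetric series for circles
if they are allowed. -/
inductive Evaluation (k : Type u) (S : Type v) : Bool → Type (max u v)
  | circles (αc : SymmetricSeries k S) : Evaluation k S false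
  | pair (αb : Series k S) (αc : SymmetricSeries k S) : Evaluation k S true

namespace Evaluation

variable {k : Type u} [Field k] {S : Type v} {inner : Bool}

/-- The series that evaluates circles. -/
def onCircles : Evaluation k S inner → SymmetricSeries k S
  | circles αc => αc
  | pair _ αc => αc

/-- The series that evaluates floating intervals (which do not occur in the first case). -/
def onIntervals : Evaluation k S inner → Series k S
  | circles _ => 0
  | pair αb _ => αb

/-- The syntactic ideal. -/
def twoSidedIdeal : Evaluation k S inner → Set (NCPoly k S)
  | circles αc => αc.toSeries.twoSidedIdeal
  | pair αb αc => αb.twoSidedIdeal ∩ αc.toSeries.twoSidedIdeal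

/-- The evaluation of a floating component. -/
def evalComponent (α : Evaluation k S inner) : Component S Empty → k
  | arc _ w _ => α.onIntervals (FreeMonoid.ofList w)
  | circle c => α.onCircles.onCycle c

/-- The evaluation of a floating diagram is multiplicative. -/
def evalDiagram (α : Evaluation k S inner) (m : Diagram S Empty) : k :=
  (m.map α.evalComponent).prod

end Evaluation

/-! The skein category. -/

section Skein

variable {k : Type u} [Field k] {S : Type v} {inner : Bool}

/-- Insert a noncommutative polynomial at the marked dot of a cobordism. -/
noncomputable def insertPoly {X Y : SignSeq} (M : Cobordism (Option S) inner X Y)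
    (u : NCPoly k S) : Cobordism S inner X Y →₀ k :=
  u.coeff.mapDomain fun t => M.subst (fill t.toList)

/-- The defining relations of the skein category, as a set of linear combinations of cobordisms
that are set to zero. -/
inductive SkeinRelation (α : Evaluation k S inner) {X Y : SignSeq} :
    (Cobordism S inner X Y →₀ k) → Prop
  /-- A floating interval is evaluated. -/
  | interval (w : List S) (x x' : Cobordism S inner X Y) (h : x'.comps = arc none w none ::ₘ x.comps) :
      SkeinRelation α
        (Finsupp.single x' 1 - α.onIntervals (FreeMonoid.ofList w) • Finsupp.single x 1)
  /-- A circle is evaluated. -/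
  | circle (c : Cycle S) (x x' : Cobordism S inner X Y) (h : x'.comps = circle c ::ₘ x.comps) :
      SkeinRelation α (Finsupp.single x' 1 - α.onCircles.onCycle c • Finsupp.single x 1)
  /-- An element of the syntactic ideal is zero anywhere along a component. -/
  | insert (M : Cobordism (Option S) inner X Y) (hM : M.comps.marks = 1) (u : NCPoly k S)
      (hu : u ∈ α.twoSidedIdeal) : SkeinRelation α (insertPoly M u)
  /-- An element of the left syntactic ideal is zero at the beginning of an interval that starts at
  an inner endpoint. -/
  | start (M : Cobordism (Option S) inner X Y) (hM : M.comps.marks = 1)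
      (hs : M.comps.MarkedStart) (u : NCPoly k S) (hu : u ∈ α.onIntervals.leftIdeal) :
      SkeinRelation α (insertPoly M u)
  /-- An element of the right syntactic ideal is zero at the end of an interval that ends at an
  inner endpoint. -/
  | finish (M : Cobordism (Option S) inner X Y) (hM : M.comps.marks = 1)
      (he : M.comps.MarkedEnd) (u : NCPoly k S) (hu : u ∈ α.onIntervals.rightIdeal) :
      SkeinRelation α (insertPoly M u)

end Skein


open Relation Diagram Component

section Skein

variable {k : Type u} [Field k] {S : Type v} {inner : Bool}

theorem SkeinRelation.comp_right {α : Evaluation k S inner} {X Y Z : SignSeq}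
    {f : Cobordism S inner X Y →₀ k} (hf : SkeinRelation α f) (y : Cobordism S inner Y Z) :
    SkeinRelation α (f.mapDomain fun x => x.comp y) := by
  have key : ∀ (M : Cobordism (Option S) inner X Y) (u : NCPoly k S),
      (insertPoly M u).mapDomain (fun x => x.comp y) = insertPoly (M.comp y.lift) u := by
    intro M u
    rw [insertPoly, insertPoly, ← Finsupp.mapDomain_comp]
    congr 1; funext t
    rw [Cobordism.subst_comp, Cobordism.subst_fill_lift]; rfl
  cases hf with
  | interval w x x' h =>
    rw [Finsupp.mapDomain_sub, Finsupp.mapDomain_smul, Finsupp.mapDomain_single,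
      Finsupp.mapDomain_single]
    exact .interval w _ _ (Cobordism.comps_comp_left (fun _ => arc none w none)
      (fun _ => rfl) h y)
  | circle c x x' h =>
    rw [Finsupp.mapDomain_sub, Finsupp.mapDomain_smul, Finsupp.mapDomain_single,
      Finsupp.mapDomain_single]
    exact .circle c _ _ (Cobordism.comps_comp_left (fun _ => Component.circle c)
      (fun _ => rfl) h y)
  | insert M hM u hu =>
    rw [key]
    exact .insert _ (by rw [Cobordism.marks_comp, hM, Cobordism.marks_lift]) u hu
  | start M hM hs u hu =>
    rw [key]
    exact .start _ (by rw [Cobordism.marks_comp, hM, Cobordism.marks_lift])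
      (Cobordism.markedStart_comp _ _ (Or.inl hs)) u hu
  | finish M hM hs u hu =>
    rw [key]
    exact .finish _ (by rw [Cobordism.marks_comp, hM, Cobordism.marks_lift])
      (Cobordism.markedEnd_comp _ _ (Or.inl hs)) u hu

theorem SkeinRelation.comp_left {α : Evaluation k S inner} {X Y Z : SignSeq}
    {f : Cobordism S inner Y Z →₀ k} (hf : SkeinRelation α f) (y : Cobordism S inner X Y) :
    SkeinRelation α (f.mapDomain fun x => y.comp x) := by
  have key : ∀ (M : Cobordism (Option S) inner Y Z) (u : NCPoly k S),
      (insertPoly M u).mapDomain (fun x => y.comp x) = insertPoly (y.lift.comp M) u := by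
    intro M u
    rw [insertPoly, insertPoly, ← Finsupp.mapDomain_comp]
    congr 1; funext t
    rw [Cobordism.subst_comp, Cobordism.subst_fill_lift]; rfl
  cases hf with
  | interval w x x' h =>
    rw [Finsupp.mapDomain_sub, Finsupp.mapDomain_smul, Finsupp.mapDomain_single,
      Finsupp.mapDomain_single]
    exact .interval w _ _ (Cobordism.comps_comp_right y (fun _ => arc none w none)
      (fun _ => rfl) h)
  | circle c x x' h =>
    rw [Finsupp.mapDomain_sub, Finsupp.mapDomain_smul, Finsupp.mapDomain_single,
      Finsupp.mapDomain_single]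
    exact .circle c _ _ (Cobordism.comps_comp_right y (fun _ => Component.circle c)
      (fun _ => rfl) h)
  | insert M hM u hu =>
    rw [key]
    exact .insert _ (by rw [Cobordism.marks_comp, hM, Cobordism.marks_lift]) u hu
  | start M hM hs u hu =>
    rw [key]
    exact .start _ (by rw [Cobordism.marks_comp, hM, Cobordism.marks_lift])
      (Cobordism.markedStart_comp _ _ (Or.inr hs)) u hu
  | finish M hM hs u hu =>
    rw [key]
    exact .finish _ (by rw [Cobordism.marks_comp, hM, Cobordism.marks_lift])
      (Cobordism.markedEnd_comp _ _ (Or.inr hs)) u hu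

/-- The `k`-linear category of cobordisms: morphisms are formal `k`-linear combinations of
cobordisms. -/
abbrev LinCob (k : Type u) [Field k] (S : Type v) (inner : Bool) : Type :=
  Free k (Cob S inner)

theorem LinCob.comp_single {X Y Z : Cob S inner} (f : Cobordism S inner X.obj Y.obj →₀ k)
    (y : Cobordism S inner Y.obj Z.obj) :
    ((show Free.of k X ⟶ Free.of k Y from f) ≫
      (show Free.of k Y ⟶ Free.of k Z from Finsupp.single y 1)) =
      f.mapDomain fun x => x.comp y := by
  show f.sum (fun x a => (Finsupp.single y 1).sum fun z b =>
    Finsupp.single (x.comp z) (a * b)) = _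
  rw [Finsupp.mapDomain]
  congr 1; funext x a
  rw [Finsupp.sum_single_index] <;> simp

theorem LinCob.single_comp {X Y Z : Cob S inner} (y : Cobordism S inner X.obj Y.obj)
    (f : Cobordism S inner Y.obj Z.obj →₀ k) :
    ((show Free.of k X ⟶ Free.of k Y from Finsupp.single y 1) ≫
      (show Free.of k Y ⟶ Free.of k Z from f)) =
      f.mapDomain fun x => y.comp x := by
  show (Finsupp.single y 1).sum (fun z b => f.sum fun x a =>
    Finsupp.single (z.comp x) (b * a)) = _
  rw [Finsupp.sum_single_index (by simp), Finsupp.mapDomain]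
  congr 1; funext x a
  simp

theorem LinCob.hom_induction {X Y : LinCob k S inner} {p : (X ⟶ Y) → Prop} (f : X ⟶ Y)
    (zero : p 0) (add : ∀ f g, p f → p g → p (f + g))
    (smul : ∀ (a : k) (x : Cobordism S inner (Cob.obj X) (Cob.obj Y)),
      p (a • (show X ⟶ Y from Finsupp.single x 1))) : p f := by
  induction f using Finsupp.induction_linear with
  | zero => exact zero
  | add f g hf hg => exact add f g hf hg
  | single x a =>
    have := smul a x
    have e : (a • (show X ⟶ Y from Finsupp.single x 1) : X ⟶ Y) = Finsupp.single x a := by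
      show a • Finsupp.single x 1 = Finsupp.single x a
      simp
    rwa [e] at this

/-- The ideal of the linear category of cobordisms spanned by the skein relations. -/
noncomputable def skeinIdeal (α : Evaluation k S inner) : HomIdeal k (LinCob k S inner) where
  carrier X Y := Submodule.span k
    {f : X ⟶ Y | SkeinRelation (X := Cob.obj X) (Y := Cob.obj Y) α f}
  comp_left {X Y Z} f {g} hg := by
    induction hg using Submodule.span_induction with
    | mem g hg =>
      induction f using LinCob.hom_induction with
      | zero => rw [Limits.zero_comp]; exact zero_mem _
      | add f f' hf hf' => rw [Preadditive.add_comp]; exact add_mem hf hf'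
      | smul a y =>
        rw [Linear.smul_comp]
        refine Submodule.smul_mem _ _ (Submodule.subset_span ?_)
        have := SkeinRelation.comp_left hg y
        exact Eq.mpr (congrArg (fun h => SkeinRelation (X := Cob.obj X) (Y := Cob.obj Z) α h)
          (LinCob.single_comp (X := X) (Y := Y) (Z := Z) y g)) this
    | zero => rw [Limits.comp_zero]; exact zero_mem _
    | add g g' _ _ h h' => rw [Preadditive.comp_add]; exact add_mem h h'
    | smul a g _ h => rw [Linear.comp_smul]; exact Submodule.smul_mem _ _ h
  comp_right {X Y Z f} g hf := by
    induction hf using Submodule.span_induction with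
    | mem f hf =>
      induction g using LinCob.hom_induction with
      | zero => rw [Limits.comp_zero]; exact zero_mem _
      | add g g' hg hg' => rw [Preadditive.comp_add]; exact add_mem hg hg'
      | smul a y =>
        rw [Linear.comp_smul]
        refine Submodule.smul_mem _ _ (Submodule.subset_span ?_)
        have := SkeinRelation.comp_right hf y
        exact Eq.mpr (congrArg (fun h => SkeinRelation (X := Cob.obj X) (Y := Cob.obj Z) α h)
          (LinCob.comp_single (X := X) (Y := Y) (Z := Z) f y)) this
    | zero => rw [Limits.zero_comp]; exact zero_mem _
    | add g g' _ _ h h' => rw [Preadditive.add_comp]; exact add_mem h h'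
    | smul a g _ h => rw [Linear.smul_comp]; exact Submodule.smul_mem _ _ h

/-- The skein category. -/
abbrev Skein (α : Evaluation k S inner) : Type := (skeinIdeal α).Quot

/-- The functor sending a cobordism to its class in the skein category. -/
noncomputable abbrev toSkein (α : Evaluation k S inner) : Cob S inner ⥤ Skein α :=
  Free.embedding k (Cob S inner) ⋙ (skeinIdeal α).proj

end Skein


open Relation Diagram Component

section Trace

variable {k : Type u} [Field k] {S : Type v} {inner : Bool} {P : Type}

theorem flatMap_fill_of_countP {w : List (Option S)} (t : List S)
    (h : (w : Multiset (Option S)).countP (fun t => t.isNone) = 0) :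
    w.flatMap (fill t) = w.flatMap (fill []) := by
  rw [Multiset.countP_eq_zero] at h
  refine List.flatMap_congr fun s hs => ?_
  rcases s with _ | s
  · exact absurd rfl (h none hs)
  · rfl

theorem exists_of_countP_eq_one {w : List (Option S)}
    (h : (w : Multiset (Option S)).countP (fun t => t.isNone) = 1) :
    ∃ w₁ w₂ : List S, ∀ t, w.flatMap (fill t) = w₁ ++ t ++ w₂ := by
  have hmem : none ∈ w := by
    have : 0 < (w : Multiset (Option S)).countP (fun t => t.isNone) := by omega
    obtain ⟨s, hs, hn⟩ := Multiset.countP_pos.1 this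
    rcases s with _ | s
    · exact hs
    · simp at hn
  obtain ⟨v₁, v₂, rfl⟩ := List.append_of_mem hmem
  rw [← Multiset.coe_add, Multiset.countP_add, ← Multiset.cons_coe,
    Multiset.countP_cons_of_pos (a := none) (p := fun t : Option S => t.isNone = true) _ rfl] at h
  refine ⟨v₁.flatMap (fill []), v₂.flatMap (fill []), fun t => ?_⟩
  rw [List.flatMap_append, List.flatMap_cons, flatMap_fill_of_countP t (by omega),
    flatMap_fill_of_countP (w := v₂) t (by omega)]
  simp [fill]

theorem Component.subst_fill_of_marks {c : Component (Option S) P} (h : c.marks = 0)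
    (t : List S) : c.subst (fill t) = c.subst (fill []) := by
  rcases c with ⟨a, w, b⟩ | c
  · simp only [Component.subst]
    rw [flatMap_fill_of_countP t h]
  · induction c using Quotient.inductionOn' with
    | h w =>
      show circle ((w.flatMap (fill t) : List S) : Cycle S) =
        circle ((w.flatMap (fill []) : List S) : Cycle S)
      rw [flatMap_fill_of_countP t h]

theorem Diagram.subst_fill_of_marks {m : Diagram (Option S) P} (h : m.marks = 0)
    (t : List S) : m.subst (fill t) = m.subst (fill []) := by
  refine Multiset.map_congr rfl fun c hc => Component.subst_fill_of_marks ?_ t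
  exact Multiset.sum_eq_zero_iff.1 h _ (Multiset.mem_map_of_mem _ hc)

namespace Evaluation

variable (α : Evaluation k S inner)

theorem evalDiagram_cons (c : Component S Empty) (m : Diagram S Empty) :
    α.evalDiagram (c ::ₘ m) = α.evalComponent c * α.evalDiagram m := by
  simp [evalDiagram]

theorem sum_onIntervals {u : NCPoly k S} (hu : u ∈ α.twoSidedIdeal) (w₁ w₂ : FreeMonoid S) :
    (u.coeff.sum fun t a => a * α.onIntervals (w₁ * t * w₂)) = 0 := by
  cases α with
  | circles αc => simp [onIntervals]
  | pair αb αc => exact Series.sum_eq_zero_of_twoSided hu.1 _ _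

theorem sum_onCircles {u : NCPoly k S} (hu : u ∈ α.twoSidedIdeal) (w₁ w₂ : FreeMonoid S) :
    (u.coeff.sum fun t a => a * α.onCircles.toSeries (w₁ * t * w₂)) = 0 := by
  cases α with
  | circles αc => exact Series.sum_eq_zero_of_twoSided hu _ _
  | pair αb αc => exact Series.sum_eq_zero_of_twoSided hu.2 _ _

theorem sum_cons {c : Component (Option S) Empty} {m : Diagram (Option S) Empty}
    (hm : m.marks = 0) {u : NCPoly k S}
    (h : (u.coeff.sum fun t a => a * α.evalComponent (c.subst (fill t.toList))) = 0) :
    (u.coeff.sum fun t a => a * α.evalDiagram (Diagram.subst (fill t.toList) (c ::ₘ m))) = 0 := by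
  have : (fun (t : FreeMonoid S) (a : k) =>
      a * α.evalDiagram (Diagram.subst (fill t.toList) (c ::ₘ m))) =
      fun t a => (a * α.evalComponent (c.subst (fill t.toList))) *
        α.evalDiagram (m.subst (fill [])) := by
    funext t a
    rw [subst_cons, evalDiagram_cons, Diagram.subst_fill_of_marks hm, mul_assoc]
  rw [this, ← Finsupp.sum_mul, h, zero_mul]

theorem sum_insert {m : Diagram (Option S) Empty} (hm : m.marks = 1) {u : NCPoly k S}
    (hu : u ∈ α.twoSidedIdeal) :
    (u.coeff.sum fun t a => a * α.evalDiagram (m.subst (fill t.toList))) = 0 := by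
  have hex : ∃ c ∈ m, c.marks ≠ 0 := by
    by_contra! h
    have : m.marks = 0 := Multiset.sum_eq_zero fun n hn => by
      obtain ⟨c, hc, rfl⟩ := Multiset.mem_map.1 hn
      exact h c hc
    omega
  obtain ⟨c, hc, hcm⟩ := hex
  obtain ⟨r, rfl⟩ := Multiset.exists_cons_of_mem hc
  have hs : c.marks + Diagram.marks r = 1 := by
    simpa [Diagram.marks] using hm
  refine α.sum_cons (by omega) ?_
  have hc1 : c.marks = 1 := by omega
  rcases c with ⟨a, w, b⟩ | c
  · obtain ⟨w₁, w₂, hw⟩ := exists_of_countP_eq_one hc1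
    have := α.sum_onIntervals hu (FreeMonoid.ofList w₁) (FreeMonoid.ofList w₂)
    convert this using 3 with t a
    simp only [Component.subst, evalComponent]
    rw [hw]; rfl
  · induction c using Quotient.inductionOn' with
    | h w =>
      obtain ⟨w₁, w₂, hw⟩ := exists_of_countP_eq_one hc1
      have := α.sum_onCircles hu (FreeMonoid.ofList w₁) (FreeMonoid.ofList w₂)
      rw [← this]
      refine Finsupp.sum_congr fun t _ => ?_
      show u.coeff t * α.onCircles.toSeries (FreeMonoid.ofList (w.flatMap (fill t.toList))) = _
      rw [hw]; rfl

theorem sum_start {m : Diagram (Option S) Empty} (hm : m.marks = 1) (hs : m.MarkedStart)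
    {u : NCPoly k S} (hu : u ∈ α.onIntervals.leftIdeal) :
    (u.coeff.sum fun t a => a * α.evalDiagram (m.subst (fill t.toList))) = 0 := by
  obtain ⟨w, b, hc⟩ := hs
  obtain ⟨r, rfl⟩ := Multiset.exists_cons_of_mem hc
  have hs : (w : Multiset (Option S)).countP (fun t => t.isNone) + 1 + Diagram.marks r = 1 := by
    simp only [Diagram.marks, Multiset.map_cons, Multiset.sum_cons, Component.marks] at hm
    rw [← Multiset.coe_add, Multiset.countP_add] at hm
    exact hm
  refine α.sum_cons (by omega) ?_
  have := Series.sum_eq_zero_of_left hu (FreeMonoid.ofList (w.flatMap (fill [])))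
  convert this using 3 with t a
  simp only [Component.subst, evalComponent]
  rw [List.flatMap_append, flatMap_fill_of_countP t.toList (by omega)]
  simp [fill]

theorem sum_finish {m : Diagram (Option S) Empty} (hm : m.marks = 1) (hs : m.MarkedEnd)
    {u : NCPoly k S} (hu : u ∈ α.onIntervals.rightIdeal) :
    (u.coeff.sum fun t a => a * α.evalDiagram (m.subst (fill t.toList))) = 0 := by
  obtain ⟨a, w, hc⟩ := hs
  obtain ⟨r, rfl⟩ := Multiset.exists_cons_of_mem hc
  have hs : 1 + (w : Multiset (Option S)).countP (fun t => t.isNone) + Diagram.marks r = 1 := by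
    simp only [Diagram.marks, Multiset.map_cons, Multiset.sum_cons, Component.marks] at hm
    rw [← Multiset.cons_coe, ← Multiset.singleton_add, Multiset.countP_add] at hm
    exact hm
  refine α.sum_cons (by omega) ?_
  have := Series.sum_eq_zero_of_right hu (FreeMonoid.ofList (w.flatMap (fill [])))
  convert this using 3 with t a
  simp only [Component.subst, evalComponent]
  rw [List.flatMap_cons, flatMap_fill_of_countP t.toList (by omega)]
  simp [fill]

end Evaluation

theorem Cobordism.reduces_closure {X : SignSeq} (x : Cobordism S inner X X) :
    Reduces (Set.range (Empty.elim : Empty → X.Pt))ᶜ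
      (x.comps.relabel (Sum.elim _root_.id _root_.id)) (x.closure.relabel Empty.elim) :=
  (gluable_closure x).reduces

theorem Cobordism.closure_cons {X : SignSeq} {x x' : Cobordism S inner X X}
    (c : ∀ P, Component S P) (hc : ∀ {P Q : Type} (f : P → Q), (c P).relabel f = c Q)
    (h : x'.comps = c _ ::ₘ x.comps) : x'.closure = c _ ::ₘ x.closure := by
  refine glue_eq (fun a => a.elim) (gluable_closure x').linear ?_
  rw [h, relabel_cons, hc, relabel_cons, hc, ← Multiset.singleton_add, ← Multiset.singleton_add]
  exact (reduces_closure x).add_left _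

theorem Cobordism.marks_closure {X : SignSeq} (x : Cobordism (Option S) inner X X) :
    x.closure.marks = x.comps.marks := by
  have := (reduces_closure x).marks_eq
  rwa [Diagram.marks_relabel, Diagram.marks_relabel] at this

/-- The trace of a linear combination of endomorphisms: close up and evaluate. -/
noncomputable def cobTrace (α : Evaluation k S inner) (X : SignSeq) :
    (Cobordism S inner X X →₀ k) →ₗ[k] k :=
  Finsupp.linearCombination k fun x => α.evalDiagram x.closure

theorem cobTrace_single (α : Evaluation k S inner) {X : SignSeq} (x : Cobordism S inner X X)
    (a : k) : cobTrace α X (Finsupp.single x a) = a * α.evalDiagram x.closure := by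
  simp [cobTrace]

theorem cobTrace_insertPoly (α : Evaluation k S inner) {X : SignSeq}
    (M : Cobordism (Option S) inner X X) (u : NCPoly k S) :
    cobTrace α X (insertPoly M u) =
      u.coeff.sum fun t a => a * α.evalDiagram (M.closure.subst (fill t.toList)) := by
  rw [cobTrace, insertPoly, Finsupp.linearCombination_mapDomain, Finsupp.linearCombination_apply]
  refine Finsupp.sum_congr fun t _ => ?_
  simp only [Function.comp, smul_eq_mul, Cobordism.closure_subst]

theorem cobTrace_eq_zero (α : Evaluation k S inner) {X : SignSeq}
    {f : Cobordism S inner X X →₀ k} (hf : SkeinRelation α f) : cobTrace α X f = 0 := by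
  cases hf with
  | interval w x x' h =>
    rw [map_sub, map_smul, cobTrace_single, cobTrace_single,
      Cobordism.closure_cons (fun _ => arc none w none) (fun _ => rfl) h,
      Evaluation.evalDiagram_cons]
    simp [Evaluation.evalComponent]
  | circle c x x' h =>
    rw [map_sub, map_smul, cobTrace_single, cobTrace_single,
      Cobordism.closure_cons (fun _ => Component.circle c) (fun _ => rfl) h,
      Evaluation.evalDiagram_cons]
    simp [Evaluation.evalComponent]
  | insert M hM u hu =>
    rw [cobTrace_insertPoly]
    exact α.sum_insert (by rw [Cobordism.marks_closure, hM]) hu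
  | start M hM hs u hu =>
    rw [cobTrace_insertPoly]
    exact α.sum_start (by rw [Cobordism.marks_closure, hM])
      ((markedStart_relabel _).1 (M.reduces_closure.markedStart ((markedStart_relabel _).2 hs))) hu
  | finish M hM hs u hu =>
    rw [cobTrace_insertPoly]
    exact α.sum_finish (by rw [Cobordism.marks_closure, hM])
      ((markedEnd_relabel _).1 (M.reduces_closure.markedEnd ((markedEnd_relabel _).2 hs))) hu

/-- The trace on the linear category of cobordisms. -/
noncomputable def linTrace (α : Evaluation k S inner) : TraceForm k (LinCob k S inner) where
  tr X := cobTrace α (Cob.obj X)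
  comm {X Y} f g := by
    induction f using LinCob.hom_induction with
    | zero => rw [Limits.zero_comp, Limits.comp_zero, map_zero]; exact (map_zero _).symm
    | add f f' hf hf' =>
      rw [Preadditive.add_comp, Preadditive.comp_add]
      exact (map_add _ _ _).trans ((congrArg₂ _ hf hf').trans (map_add _ _ _).symm)
    | smul a x =>
      rw [Linear.smul_comp, Linear.comp_smul]
      refine (map_smul _ _ _).trans (Eq.trans ?_ (map_smul _ _ _).symm)
      congr 1
      induction g using LinCob.hom_induction with
      | zero => rw [Limits.zero_comp, Limits.comp_zero, map_zero]; exact (map_zero _).symm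
      | add f f' hf hf' =>
        rw [Preadditive.add_comp, Preadditive.comp_add]
        exact (map_add _ _ _).trans ((congrArg₂ _ hf hf').trans (map_add _ _ _).symm)
      | smul b y =>
        rw [Linear.smul_comp, Linear.comp_smul]
        refine (map_smul _ _ _).trans (Eq.trans ?_ (map_smul _ _ _).symm)
        congr 1
        have e1 := (LinCob.comp_single (X := X) (Y := Y) (Z := X) (Finsupp.single x (1 : k)) y).trans
          Finsupp.mapDomain_single
        have e2 := (LinCob.comp_single (X := Y) (Y := X) (Z := Y) (Finsupp.single y (1 : k)) x).trans
          Finsupp.mapDomain_single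
        refine (congrArg (cobTrace α (Cob.obj X)) e1).trans
          (Eq.trans ?_ (congrArg (cobTrace α (Cob.obj Y)) e2).symm)
        rw [cobTrace_single, cobTrace_single, Cobordism.closure_comp_comm]

/-- The trace on the skein category. -/
noncomputable def skeinTrace (α : Evaluation k S inner) : TraceForm k (Skein α) :=
  (linTrace α).ofQuot (skeinIdeal α) (by
    intro X f hf
    induction hf using Submodule.span_induction with
    | mem f hf => exact cobTrace_eq_zero α hf
    | zero => exact map_zero _
    | add f g _ _ hf hg => exact (map_add _ _ _).trans (by rw [hf, hg, add_zero])
    | smul a f _ hf => exact (map_smul _ _ _).trans (by rw [hf, smul_zero]))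

end Trace


/-! The square of categories attached to an evaluation. -/

section Square

variable {k : Type u} [Field k] {S : Type v} {inner : Bool} (α : Evaluation k S inner)

/-- The gligible category: the quotient of the skein category by negligible morphisms. -/
abbrev Gligible : Type := (skeinTrace α).Gligible

/-- The Deligne category: the additive Karoubi closure of the skein category. -/
abbrev Deligne : Type (max 1 u v) :=
  AddKar (Skein α)

/-- The gligible quotient of the Deligne category. -/
abbrev GligibleDeligne : Type (max 1 u v) := (skeinTrace α).addKar.Gligible

noncomputable abbrev skeinToGligible : Skein α ⥤ Gligible α := (skeinTrace α).toGligible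

noncomputable abbrev skeinToDeligne : Skein α ⥤ Deligne α := toAddKar (Skein α)

noncomputable abbrev gligibleToGligibleDeligne : Gligible α ⥤ GligibleDeligne α :=
  (skeinTrace α).gligibleToAddKar

noncomputable abbrev deligneToGligibleDeligne : Deligne α ⥤ GligibleDeligne α :=
  (skeinTrace α).addKar.toGligible

/-- The square of functors commutes. -/
theorem square_comm : skeinToGligible α ⋙ gligibleToGligibleDeligne α =
    skeinToDeligne α ⋙ deligneToGligibleDeligne α := rfl

end Square

end DecCob

/-! If floating intervals evaluate to zero, the left and right syntactic ideals of the interval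
series are the whole algebra, so they contain `1`. Inserting `1` next to an inner endpoint changes
nothing, and yet the result is a relation. Hence every cobordism with an inner endpoint is zero in
the larger skein category (`skeinRelation_of_hasInnerEnd`). The two-sided ideal of the zero series
is also everything, so intersecting with it imposes no condition, and on cobordisms without inner
endpoints the two settings have the same insertion relations.

To turn this into an equivalence, a functor is built in the direction from the larger category to
the smaller one: `truncate` discards all cobordisms with inner endpoints. It is a functor because
gluing neither creates nor destroys inner endpoints (`hasInnerEnd_comp`). It sends each skein
relation to zero or to a skein relation, and the linear inclusion `extend` is a section that also
sends relations to relations. Since `f - extend (truncate f)` always lies in the skein ideal, a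
combination is zero in the larger skein category as soon as its truncation is zero in the smaller
one (`mem_skeinIdeal_of_truncate`). So the induced functor `skeinComparison` is full and faithful,
and both categories have the same sign sequences as objects. It preserves traces: the closure of a
cobordism with an inner endpoint contains a floating interval, whose value is zero
(`cobTrace_truncate`).

The other three equivalences are formal. An additive equivalence extends to matrices and to formal
images of idempotents, and the extension preserves the extended trace. An equivalence that preserves
traces preserves and reflects negligible morphisms, so it descends to the gligible quotients. Three
of the four squares then commute either strictly or through explicit identity matrices, and the
isomorphism for the fourth is the quotient image of the isomorphism for the Deligne square, which
makes the coherence equation immediate. -/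

namespace DecCob

universe u v w v'

open Idempotents

section Functors

variable {k : Type u} [Field k] {C : Type v} [Category.{w} C] [Preadditive C]
  [CategoryTheory.Linear k C] {D : Type v'} [Category.{w} D] [Preadditive D]
  [CategoryTheory.Linear k D]

/-! ### Functors that preserve traces, and the quotients by negligible morphisms. -/

namespace TraceForm

variable {t : TraceForm k C} {s : TraceForm k D}

/-- A full functor that preserves traces also preserves negligible morphisms. -/
theorem map_mem_negligible (F : C ⥤ D) [F.Full]
    (h : ∀ (X : C) (f : X ⟶ X), s.tr _ (F.map f) = t.tr X f) {X Y : C} {f : X ⟶ Y}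
    (hf : f ∈ t.negligible.carrier X Y) : F.map f ∈ s.negligible.carrier _ _ := by
  intro z
  -- Fullness is needed here: negligibility in `D` is tested against all morphisms between the
  -- images, and each of them must come from `C`.
  obtain ⟨z, rfl⟩ := F.map_surjective z
  rw [← F.map_comp, h]
  exact hf z

/-- A functor that preserves traces reflects negligible morphisms. -/
theorem mem_negligible_of_map (F : C ⥤ D)
    (h : ∀ (X : C) (f : X ⟶ X), s.tr _ (F.map f) = t.tr X f) {X Y : C} {f : X ⟶ Y}
    (hf : F.map f ∈ s.negligible.carrier _ _) : f ∈ t.negligible.carrier X Y := by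
  intro z
  rw [← h, F.map_comp]
  exact hf _

variable (F : C ⥤ D) [F.Additive]

/-- The functor between gligible quotients induced by a full functor that preserves traces. -/
def mapGligible [F.Full] (h : ∀ (X : C) (f : X ⟶ X), s.tr _ (F.map f) = t.tr X f) :
    t.Gligible ⥤ s.Gligible :=
  CategoryTheory.Quotient.lift _ (F ⋙ s.toGligible) (by
    intro X Y f g hfg
    refine (Quotient.functor_map_eq_iff _ _ _).2 ?_
    show F.map f - F.map g ∈ _
    rw [← F.map_sub]
    exact map_mem_negligible F h hfg)

variable [F.Full] (h : ∀ (X : C) (f : X ⟶ X), s.tr _ (F.map f) = t.tr X f)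

instance : (mapGligible F h).Full where
  map_surjective := by
    rintro ⟨X⟩ ⟨Y⟩ ⟨f⟩
    obtain ⟨f, rfl⟩ := F.map_surjective f
    exact ⟨t.toGligible.map f, rfl⟩

/-- Faithfulness of `F` plays no role: two morphisms with congruent images differ by a morphism
whose image is negligible, and negligibility is reflected because traces are preserved. -/
instance : (mapGligible F h).Faithful where
  map_injective := by
    rintro ⟨X⟩ ⟨Y⟩ ⟨f⟩ ⟨g⟩ hfg
    have hfg : s.toGligible.map (F.map f) = s.toGligible.map (F.map g) := hfg
    refine (Quotient.functor_map_eq_iff t.negligible.rel f g).2 ?_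
    show f - g ∈ _
    refine mem_negligible_of_map F h ?_
    rw [F.map_sub]
    exact (Quotient.functor_map_eq_iff s.negligible.rel _ _).1 hfg

instance [F.EssSurj] : (mapGligible F h).EssSurj where
  mem_essImage := by
    rintro ⟨Y⟩
    exact ⟨t.toGligible.obj (F.objPreimage Y), ⟨s.toGligible.mapIso (F.objObjPreimageIso Y)⟩⟩

instance [F.IsEquivalence] : (mapGligible F h).IsEquivalence where

instance : (mapGligible F h).Additive where
  map_add := by
    rintro ⟨X⟩ ⟨Y⟩ ⟨f⟩ ⟨g⟩
    exact congrArg s.toGligible.map (F.map_add (f := f) (g := g))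

instance [F.Linear k] : (mapGligible F h).Linear k where
  map_smul := by
    rintro ⟨X⟩ ⟨Y⟩ ⟨f⟩ r
    exact congrArg s.toGligible.map (F.map_smul r f)

end TraceForm

/-! ### Passage to formal finite direct sums. -/

section Matrices

variable (F : C ⥤ D) [F.Additive]

/-- Morphisms are matrices on which the functor acts entrywise, so preimages can be chosen one entry
at a time. -/
instance [F.Full] : F.mapMat_.Full where
  map_surjective f := ⟨fun i j => F.preimage (f i j), by ext i j; exact F.map_preimage _⟩

instance [F.Faithful] : F.mapMat_.Faithful where
  map_injective {M N f g} h := by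
    ext i j
    exact F.map_injective (congrFun (congrFun h i) j)

open Classical in
/-- The diagonal morphism between formal direct sums given by a family of morphisms. -/
noncomputable def matDiag {ι : Type} [Fintype ι] {X Y : ι → C} (f : ∀ i, X i ⟶ Y i) :
    (⟨ι, X⟩ : Mat_ C) ⟶ ⟨ι, Y⟩ :=
  fun i j => if h : i = j then f i ≫ eqToHom (congrArg Y h) else 0

theorem matDiag_id {ι : Type} [Fintype ι] (X : ι → C) :
    matDiag (fun i => 𝟙 (X i)) = 𝟙 (⟨ι, X⟩ : Mat_ C) := by
  ext i j
  by_cases h : i = j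
  · subst h; simp [matDiag]
  · simp [matDiag, h]

theorem matDiag_comp {ι : Type} [Fintype ι] {X Y Z : ι → C} (f : ∀ i, X i ⟶ Y i)
    (g : ∀ i, Y i ⟶ Z i) : matDiag f ≫ matDiag g = matDiag fun i => f i ≫ g i := by
  ext i j
  rw [Mat_.comp_apply, Finset.sum_eq_single i
    -- In the sum over the middle index only `l = i` survives, since the first factor is diagonal.
    (fun l _ hl => by simp [matDiag, hl.symm]) (by simp)]
  by_cases h : i = j
  · subst h; simp [matDiag]
  · simp [matDiag, h]

/-- Isomorphic families of objects have isomorphic formal direct sums. -/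
noncomputable def matIso {ι : Type} [Fintype ι] {X Y : ι → C} (e : ∀ i, X i ≅ Y i) :
    (⟨ι, X⟩ : Mat_ C) ≅ ⟨ι, Y⟩ where
  hom := matDiag fun i => (e i).hom
  inv := matDiag fun i => (e i).inv
  hom_inv_id := by simp [matDiag_comp, matDiag_id]
  inv_hom_id := by simp [matDiag_comp, matDiag_id]

/-- Preimages are chosen summand by summand over the same index set; the diagonal matrix of the
chosen isomorphisms then compares the two direct sums. -/
instance [F.EssSurj] : F.mapMat_.EssSurj where
  mem_essImage N := ⟨⟨N.ι, fun i => F.objPreimage (N.X i)⟩,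
    ⟨matIso fun i => F.objObjPreimageIso (N.X i)⟩⟩

instance [F.IsEquivalence] : F.mapMat_.IsEquivalence where

instance : F.mapMat_.Additive where
  map_add := by
    intros
    ext i j
    exact F.map_add

instance [F.Linear k] : F.mapMat_.Linear k where
  map_smul f r := by
    ext i j
    exact F.map_smul r (f i j)

end Matrices

/-! ### Passage to formal images of idempotents. -/

section KaroubiEnvelope

variable (F : C ⥤ D)

/-- The functor between Karoubi envelopes induced by a functor. -/
def mapKaroubi : Karoubi C ⥤ Karoubi D where
  obj P := ⟨F.obj P.X, F.map P.p, by rw [← F.map_comp, P.idem]⟩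
  map f := ⟨F.map f.f, by
    show F.map _ ≫ F.map _ ≫ F.map _ = F.map _
    rw [← F.map_comp, ← F.map_comp, f.comm]⟩
  map_id _ := rfl
  map_comp f g := by ext; exact F.map_comp f.f g.f

/-- Faithfulness enters because a preimage of the underlying morphism must itself absorb the two
idempotents, and this identity is known only after applying `F`. -/
instance [F.Full] [F.Faithful] : (mapKaroubi F).Full where
  map_surjective {P Q} f := by
    obtain ⟨g, hg⟩ : ∃ g : P.X ⟶ Q.X, F.map g = f.f := F.map_surjective f.f
    refine ⟨⟨g, F.map_injective ?_⟩, ?_⟩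
    · rw [F.map_comp, F.map_comp, hg]
      exact f.comm
    · ext
      exact hg

instance [F.Faithful] : (mapKaroubi F).Faithful where
  map_injective h := by
    ext
    exact F.map_injective (congrArg Karoubi.Hom.f h)

/-- Conjugating the idempotent by an isomorphism of `Q.X` with an object in the image of `F` gives
an idempotent on that object. It lifts by fullness, and the lift is idempotent by faithfulness. -/
instance [F.Full] [F.Faithful] [F.EssSurj] : (mapKaroubi F).EssSurj where
  mem_essImage Q := by
    let e := F.objObjPreimageIso Q.X
    have hp : F.map (F.preimage (e.hom ≫ Q.p ≫ e.inv)) = e.hom ≫ Q.p ≫ e.inv := F.map_preimage _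
    refine ⟨⟨F.objPreimage Q.X, F.preimage (e.hom ≫ Q.p ≫ e.inv), F.map_injective ?_⟩, ⟨?_⟩⟩
    · rw [F.map_comp, hp]
      simp
    · exact
      -- The isomorphism `e` alone need not be a morphism of formal images: it must be cut down by
      -- the idempotent. The identity of a formal image is its idempotent, so the two composites
      -- below have to give idempotents.
      { hom := ⟨e.hom ≫ Q.p, by
          show F.map _ ≫ (e.hom ≫ Q.p) ≫ Q.p = e.hom ≫ Q.p
          rw [hp]; simp⟩
        inv := ⟨Q.p ≫ e.inv, by
          show Q.p ≫ (Q.p ≫ e.inv) ≫ F.map _ = Q.p ≫ e.inv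
          rw [hp]; simp⟩
        hom_inv_id := by
          ext
          show (e.hom ≫ Q.p) ≫ Q.p ≫ e.inv = F.map _
          rw [hp]; simp
        inv_hom_id := by
          ext
          show (Q.p ≫ e.inv) ≫ e.hom ≫ Q.p = Q.p
          simp }

instance [F.IsEquivalence] : (mapKaroubi F).IsEquivalence where

instance [F.Additive] : (mapKaroubi F).Additive where
  map_add := by
    intros
    ext
    exact F.map_add

instance [F.Additive] [F.Linear k] : (mapKaroubi F).Linear k where
  map_smul f r := by
    ext
    exact F.map_smul r f.f

end KaroubiEnvelope

/-! ### The additive Karoubi closure: traces and compatibility with the inclusions. -/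

section AdditiveKaroubiClosure

variable (F : C ⥤ D) [F.Additive]

/-- The functor between additive Karoubi closures induced by an additive functor. -/
noncomputable abbrev mapAddKar : AddKar C ⥤ AddKar D := mapKaroubi F.mapMat_

/-- The extended trace is the sum of the traces of the diagonal entries of the underlying matrix,
and the extended functor keeps the index set and applies `F` to each entry. The claim therefore
holds term by term. -/
theorem TraceForm.addKar_map {t : TraceForm k C} {s : TraceForm k D}
    (h : ∀ (X : C) (f : X ⟶ X), s.tr _ (F.map f) = t.tr X f) (P : AddKar C) (f : P ⟶ P) :
    s.addKar.tr _ ((mapAddKar F).map f) = t.addKar.tr P f :=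
  Finset.sum_congr rfl fun _ _ => h _ _

/-- Extending a functor to additive Karoubi closures is compatible with the inclusions. -/
noncomputable def toAddKarIso : F ⋙ toAddKar D ≅ toAddKar C ⋙ mapAddKar F :=
  NatIso.ofComponents
    (fun X =>
      -- Both functors give the same underlying one-term direct sum, but one with the idempotent `𝟙`
      -- and the other with the image of `𝟙`. These are equal by functoriality, so identity matrices
      -- give mutually inverse morphisms.
      have h : F.mapMat_.map (𝟙 ((Mat_.embedding C).obj X)) =
        𝟙 ((Mat_.embedding D).obj (F.obj X)) := F.mapMat_.map_id _
      { hom := ⟨𝟙 ((Mat_.embedding D).obj (F.obj X)),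
          (Category.id_comp _).trans ((Category.id_comp _).trans h)⟩
        inv := ⟨𝟙 ((Mat_.embedding D).obj (F.obj X)),
          (congrArg (· ≫ _) h).trans ((Category.id_comp _).trans (Category.id_comp _))⟩
        hom_inv_id := Karoubi.hom_ext _ _ (Category.id_comp _)
        inv_hom_id := Karoubi.hom_ext _ _ ((Category.id_comp _).trans h.symm) })
    (fun {X Y} f => by
      ext : 1
      show (Mat_.embedding D).map (F.map f) ≫ 𝟙 _ = 𝟙 _ ≫ F.mapMat_.map ((Mat_.embedding C).map f)
      rw [Category.comp_id, Category.id_comp]; rfl)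

/-- The functors between gligible quotients induced by a functor and by its extension to additive
Karoubi closures are compatible. -/
noncomputable def gligibleToAddKarIso [F.Full] [F.mapMat_.Full] [F.mapMat_.Faithful]
    {t : TraceForm k C} {s : TraceForm k D}
    (h : ∀ (X : C) (f : X ⟶ X), s.tr _ (F.map f) = t.tr X f)
    (h' : ∀ (P : AddKar C) (f : P ⟶ P), s.addKar.tr _ ((mapAddKar F).map f) = t.addKar.tr P f) :
    TraceForm.mapGligible F h ⋙ s.gligibleToAddKar ≅
      t.gligibleToAddKar ⋙ TraceForm.mapGligible (mapAddKar F) h' :=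
  -- Taking the classes of the components of `toAddKarIso`, and not some other isomorphisms, is what
  -- yields the coherence of the square in the main theorem.
  NatIso.ofComponents (fun X => s.addKar.toGligible.mapIso ((toAddKarIso F).app X.as)) (by
    rintro ⟨X⟩ ⟨Y⟩ ⟨f⟩
    exact congrArg s.addKar.toGligible.map ((toAddKarIso F).hom.naturality f))

end AdditiveKaroubiClosure

end Functors

open Relation Diagram Component

variable {S : Type u} {T : Type v}

/-! ### Inner endpoints under gluing, and marking a place on an interval. -/

namespace Cobordism

variable {inner : Bool} {X Y Z : SignSeq}

/-- Some component of the cobordism is an interval with an inner endpoint. -/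
def HasInnerEnd (x : Cobordism S inner X Y) : Prop := ∃ c ∈ x.comps, c.HasInnerEnd

/-- Gluing happens only at boundary points: joining two arcs keeps their outer ends, and an arc that
closes to a circle has no inner end. So the cobordisms with inner endpoints behave like an ideal
whose complement is closed under composition, and discarding them is functorial. -/
theorem hasInnerEnd_comp (x : Cobordism S inner X Y) (y : Cobordism S inner Y Z) :
    (comp x y).HasInnerEnd ↔ x.HasInnerEnd ∨ y.HasInnerEnd := by
  refine (gluable_stack x y).hasInnerEnd.trans ?_
  simp [stack, Diagram.relabel, HasInnerEnd, or_and_right, exists_or]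

theorem hasInnerEnd_subst (φ : S → List T) (x : Cobordism S inner X Y) :
    (x.subst φ).HasInnerEnd ↔ x.HasInnerEnd := by
  simp [HasInnerEnd, subst, Diagram.subst]

/-- A closure has no boundary points left, so an arc with an inner end in it is a floating interval.
The trace computation rests on this. -/
theorem hasInnerEnd_closure (x : Cobordism S inner X X) :
    (∃ c ∈ x.closure, c.HasInnerEnd) ↔ x.HasInnerEnd := by
  refine (gluable_closure x).hasInnerEnd.trans ?_
  simp [Diagram.relabel, HasInnerEnd]

/-- A cobordism without inner endpoints as a cobordism for which they are allowed. -/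
def allowInner (x : Cobordism S false X Y) : Cobordism S true X Y :=
  ⟨x.comps, x.boundary, nofun⟩

theorem not_hasInnerEnd (x : Cobordism S false X Y) : ¬ x.HasInnerEnd :=
  fun ⟨c, hc, h⟩ => x.not_inner rfl c hc h

theorem not_hasInnerEnd_allowInner (x : Cobordism S false X Y) : ¬ x.allowInner.HasInnerEnd :=
  x.not_hasInnerEnd

/-- Together with `allowInner_injective` this identifies the morphisms of the smaller category with
the cobordisms of the larger one that have no inner endpoint. -/
theorem exists_allowInner_eq {x : Cobordism S true X Y} (h : ¬ x.HasInnerEnd) :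
    ∃ y : Cobordism S false X Y, y.allowInner = x :=
  ⟨⟨x.comps, x.boundary, fun _ c hc hi => h ⟨c, hc, hi⟩⟩, rfl⟩

theorem allowInner_injective :
    (allowInner : Cobordism S false X Y → Cobordism S true X Y).Injective :=
  fun x y h => Cobordism.ext (show x.allowInner.comps = y.allowInner.comps from congrArg comps h)

/-- The boundary sees only the endpoints of the arcs. This and `ends_cons_subst` transfer the
boundary condition of `x` to the marked diagram in `exists_mark`. -/
theorem starts_cons_subst {P : Type} (m : Diagram S P) (a b : Option P) (w : List S)
    (w' : List T) (φ : S → List T) :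
    starts (arc a w' b ::ₘ m.subst φ) = starts (arc a w b ::ₘ m) := by
  cases a <;> simp

theorem ends_cons_subst {P : Type} (m : Diagram S P) (a b : Option P) (w : List S)
    (w' : List T) (φ : S → List T) :
    ends (arc a w' b ::ₘ m.subst φ) = ends (arc a w b ::ₘ m) := by
  cases b <;> simp

/-- Every place along an interval of a cobordism can be marked. -/
theorem exists_mark {x : Cobordism S true X Y} {a b : Option (X.Pt ⊕ Y.Pt)} {w : List S}
    {r : Diagram S (X.Pt ⊕ Y.Pt)} (hx : x.comps = arc a w b ::ₘ r) (w₁ w₂ : List S)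
    (hw : w₁ ++ w₂ = w) :
    ∃ M : Cobordism (Option S) true X Y, M.comps.marks = 1 ∧ M.subst (fill []) = x ∧
      arc a (w₁.flatMap (fun s => [some s]) ++ none :: w₂.flatMap fun s => [some s]) b ∈
        M.comps := by
  subst hw
  let y : Cobordism (Option S) true X Y := x.lift
  have hy : y.comps = _ := congrArg (Diagram.subst fun s => [some s]) hx
  have hm := x.marks_lift
  have hs := congrArg comps (x.subst_fill_lift [])
  rw [show x.lift.comps = _ from hy, subst_cons] at hm
  change Diagram.subst (fill []) y.comps = x.comps at hs
  rw [hy, subst_cons, subst_cons] at hs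
  have hb := x.boundary
  rw [hx] at hb
  -- The witness is the lift of `x`, in which no dot is marked, with one mark placed between `w₁`
  -- and `w₂`.
  refine ⟨⟨arc a (w₁.flatMap (fun s => [some s]) ++ none :: w₂.flatMap fun s => [some s]) b ::ₘ
    r.subst fun s => [some s], ⟨⟨?_, ?_⟩, ?_, ?_⟩, nofun⟩, ?_, ?_, Multiset.mem_cons_self _ _⟩
  · rw [starts_cons_subst]; exact hb.linear.1
  · rw [ends_cons_subst]; exact hb.linear.2
  · rw [starts_cons_subst]; exact hb.mem_starts
  · rw [ends_cons_subst]; exact hb.mem_ends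
  -- The lift has no marks by `marks_lift`, and the new letter contributes exactly one.
  · simp only [Diagram.marks, Multiset.map_cons, Multiset.sum_cons, Component.marks,
      Component.subst, List.flatMap_append, Multiset.coe_countP, List.countP_append,
      List.countP_cons_of_pos (a := (none : Option S)) (p := fun t => decide (t.isNone = true)) rfl]
      at hm ⊢
    omega
  -- Filling with the empty word erases the mark, so the result is the same as filling the unmarked
  -- lift, which is `x`.
  · refine Cobordism.ext (Eq.trans ?_ hs)
    show Diagram.subst (fill []) (_ ::ₘ _) = _
    rw [subst_cons]
    congr 1
    simp [Component.subst, fill]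

end Cobordism

/-! ### Discarding inner endpoints, and its effect on skein relations and traces. -/

section Truncation

variable {k : Type v} [Field k] {X Y : SignSeq}

open Cobordism

open Classical in
/-- Discard the cobordisms with inner endpoints. -/
noncomputable def truncate : (Cobordism S true X Y →₀ k) →ₗ[k] (Cobordism S false X Y →₀ k) :=
  Finsupp.linearCombination k fun x =>
    -- The chosen cobordism is unique by `allowInner_injective`.
    if h : x.HasInnerEnd then 0 else Finsupp.single (exists_allowInner_eq h).choose 1

/-- Allow inner endpoints. -/
noncomputable def extend : (Cobordism S false X Y →₀ k) →ₗ[k] (Cobordism S true X Y →₀ k) :=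
  Finsupp.lmapDomain k k allowInner

theorem extend_single (x : Cobordism S false X Y) (a : k) :
    extend (Finsupp.single x a) = Finsupp.single x.allowInner a :=
  Finsupp.mapDomain_single

theorem truncate_single_of_hasInnerEnd {x : Cobordism S true X Y} (h : x.HasInnerEnd) (a : k) :
    truncate (Finsupp.single x a) = 0 := by
  rw [truncate, Finsupp.linearCombination_single, dif_pos h, smul_zero]

theorem truncate_single_allowInner (x : Cobordism S false X Y) (a : k) :
    truncate (Finsupp.single x.allowInner a) = Finsupp.single x a := by
  have h := x.not_hasInnerEnd_allowInner
  rw [truncate, Finsupp.linearCombination_single, dif_neg h,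
    allowInner_injective (exists_allowInner_eq h).choose_spec, Finsupp.smul_single, smul_eq_mul,
    mul_one]

/-- This direction holds on the nose; the other composite is the identity only modulo the skein
relations, by `sub_extend_truncate_mem`. -/
theorem truncate_extend (f : Cobordism S false X Y →₀ k) : truncate (extend f) = f := by
  induction f using Finsupp.induction_linear with
  | zero => simp
  | add f g hf hg => rw [map_add, map_add, hf, hg]
  | single x a => rw [extend_single, truncate_single_allowInner]

theorem extend_insertPoly (M : Cobordism (Option S) false X Y) (p : NCPoly k S) :
    extend (insertPoly M p) = insertPoly M.allowInner p := by
  rw [extend, Finsupp.lmapDomain_apply, insertPoly, ← Finsupp.mapDomain_comp]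
  rfl

/-- Filling the mark does not move endpoints, so every term of the insertion has an inner endpoint
and is discarded. -/
theorem truncate_insertPoly_of_hasInnerEnd {M : Cobordism (Option S) true X Y}
    (h : M.HasInnerEnd) (p : NCPoly k S) : truncate (insertPoly M p) = 0 := by
  rw [insertPoly, Finsupp.mapDomain, Finsupp.sum, map_sum]
  exact Finset.sum_eq_zero fun t _ =>
    truncate_single_of_hasInnerEnd ((hasInnerEnd_subst _ M).2 h) _

variable {αc : SymmetricSeries k S}

/-- The zero series has the whole algebra as its syntactic ideal, so intersecting with it has no
effect. -/
theorem mem_twoSidedIdeal_pair_zero {p : NCPoly k S} :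
    p ∈ (Evaluation.pair 0 αc).twoSidedIdeal ↔ p ∈ (Evaluation.circles αc).twoSidedIdeal :=
  and_iff_right fun v w => by simp [Series.eval_eq_sum]

/-- Without inner endpoints only the circle and the two-sided insertion relations can occur, and
both keep their form when inner endpoints are allowed. -/
theorem SkeinRelation.extend {f : Cobordism S false X Y →₀ k}
    (hf : SkeinRelation (.circles αc) f) : SkeinRelation (.pair 0 αc) (extend f) := by
  cases hf with
  | interval w x x' h =>
    exact absurd ⟨arc none w none, by rw [h]; exact Multiset.mem_cons_self _ _, Or.inl rfl⟩
      x'.not_hasInnerEnd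
  | circle c x x' h =>
    rw [map_sub, map_smul, extend_single, extend_single]
    exact .circle c _ _ h
  | insert M hM p hp =>
    rw [extend_insertPoly]
    exact .insert (α := .pair 0 αc) M.allowInner hM p (mem_twoSidedIdeal_pair_zero.2 hp)
  | start M hM hs p hp =>
    obtain ⟨w, b, hs⟩ := hs
    exact absurd ⟨_, hs, Or.inl rfl⟩ M.not_hasInnerEnd
  | finish M hM he p hp =>
    obtain ⟨a, w, he⟩ := he
    exact absurd ⟨_, he, Or.inr rfl⟩ M.not_hasInnerEnd

/-- A relation of the larger category either lives on cobordisms without inner endpoints, where it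
is a relation of the smaller one, or loses all its terms. The interval relation is the only one that
could mix the two kinds, and its second term has coefficient zero. -/
theorem SkeinRelation.truncate {f : Cobordism S true X Y →₀ k}
    (hf : SkeinRelation (.pair 0 αc) f) :
    truncate f = 0 ∨ SkeinRelation (.circles αc) (truncate f) := by
  cases hf with
  | interval w x x' h =>
    left
    rw [map_sub, map_smul, truncate_single_of_hasInnerEnd
      ⟨arc none w none, by rw [h]; exact Multiset.mem_cons_self _ _, Or.inl rfl⟩, zero_sub, neg_eq_zero]
    -- The coefficient is a value of the zero series; `x` itself may well have no inner endpoint and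
    -- survive truncation.
    exact zero_smul k _
  | circle c x x' h =>
    rw [map_sub, map_smul]
    -- Removing a circle does not affect inner endpoints, so both terms survive or neither does.
    have hiff : x'.HasInnerEnd ↔ x.HasInnerEnd := by
      simp [Cobordism.HasInnerEnd, h, Component.HasInnerEnd]
    by_cases hx : x.HasInnerEnd
    · left
      rw [truncate_single_of_hasInnerEnd hx, truncate_single_of_hasInnerEnd (hiff.2 hx),
        smul_zero, sub_zero]
    · right
      obtain ⟨y', rfl⟩ := exists_allowInner_eq (mt hiff.1 hx)
      obtain ⟨y, rfl⟩ := exists_allowInner_eq hx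
      rw [truncate_single_allowInner, truncate_single_allowInner]
      exact .circle c _ _ h
  | insert M hM p hp =>
    by_cases hx : M.HasInnerEnd
    · exact .inl (truncate_insertPoly_of_hasInnerEnd hx p)
    · right
      obtain ⟨N, rfl⟩ := exists_allowInner_eq hx
      rw [← extend_insertPoly, truncate_extend]
      exact .insert N hM p (mem_twoSidedIdeal_pair_zero.1 hp)
  | start M hM hs p hp =>
    obtain ⟨w, b, hs⟩ := hs
    exact .inl (truncate_insertPoly_of_hasInnerEnd ⟨_, hs, Or.inl rfl⟩ p)
  | finish M hM he p hp =>
    obtain ⟨a, w, he⟩ := he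
    exact .inl (truncate_insertPoly_of_hasInnerEnd ⟨_, he, Or.inr rfl⟩ p)

/-- The unit of the algebra is the empty word, so inserting it erases the mark. In this way any
single cobordism with a markable place is an insertion. -/
theorem insertPoly_one (M : Cobordism (Option S) true X Y) :
    insertPoly M (1 : NCPoly k S) = Finsupp.single (M.subst (fill [])) 1 := by
  rw [insertPoly, MonoidAlgebra.one_def, MonoidAlgebra.coeff_single, Finsupp.mapDomain_single]
  rfl

/-- If floating intervals evaluate to zero, then every cobordism with an inner endpoint vanishes in
the skein category. -/
theorem skeinRelation_of_hasInnerEnd {x : Cobordism S true X Y} (h : x.HasInnerEnd) :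
    SkeinRelation (.pair 0 αc) (Finsupp.single x (1 : k)) := by
  obtain ⟨c, hc, h⟩ := h
  obtain ⟨r, hr⟩ := Multiset.exists_cons_of_mem hc
  rcases c with ⟨a, w, b⟩ | c
  · rcases h with rfl | rfl
    -- Words are written from right to left along the orientation, so the beginning of the interval
    -- is the right end of its word; in the other case the mark goes to the left end.
    · obtain ⟨M, hM, rfl, hs⟩ := exists_mark hr w [] (by simp)
      rw [← insertPoly_one]
      -- The element `1` lies in the left ideal because the interval series is zero.
      exact .start M hM ⟨_, _, hs⟩ 1
        (fun v => by simp [Evaluation.onIntervals, Series.eval_eq_sum])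
    · obtain ⟨M, hM, rfl, hs⟩ := exists_mark hr [] w (by simp)
      rw [← insertPoly_one]
      exact .finish M hM ⟨_, _, hs⟩ 1
        (fun v => by simp [Evaluation.onIntervals, Series.eval_eq_sum])
  · exact h.elim

/-- By linearity a single cobordism suffices: with an inner endpoint it is itself a relation, and
without one the difference is zero. -/
theorem sub_extend_truncate_mem (f : Cobordism S true X Y →₀ k) :
    f - extend (truncate f) ∈ Submodule.span k
      {g : Cobordism S true X Y →₀ k | SkeinRelation (.pair 0 αc) g} := by
  induction f using Finsupp.induction_linear with
  | zero => simp
  | add f g hf hg =>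
    rw [map_add, map_add, add_sub_add_comm]
    exact add_mem hf hg
  | single x a =>
    by_cases hx : x.HasInnerEnd
    · rw [truncate_single_of_hasInnerEnd hx, map_zero, sub_zero, ← mul_one a, ← smul_eq_mul,
        ← Finsupp.smul_single]
      exact Submodule.smul_mem _ _ (Submodule.subset_span (skeinRelation_of_hasInnerEnd hx))
    · obtain ⟨y, rfl⟩ := exists_allowInner_eq hx
      rw [truncate_single_allowInner, extend_single, sub_self]
      exact zero_mem _

/-- The evaluation by circles alone carries the zero series as its default value on intervals, so
there is no exception for arcs. -/
theorem evalComponent_pair_zero (c : Component S Empty) :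
    (Evaluation.pair 0 αc).evalComponent c = (Evaluation.circles αc).evalComponent c := by
  cases c <;> rfl

/-- A discarded cobordism already has trace zero: its closure contains a floating interval, which
contributes a zero factor to the product. All others have the same closure and the same values on
both sides. -/
theorem cobTrace_truncate (f : Cobordism S true X X →₀ k) :
    cobTrace (.circles αc) X (truncate f) = cobTrace (.pair 0 αc) X f := by
  induction f using Finsupp.induction_linear with
  | zero => simp
  | add f g hf hg => rw [map_add, map_add, map_add, hf, hg]
  | single x a =>
    by_cases hx : x.HasInnerEnd
    · rw [truncate_single_of_hasInnerEnd hx, map_zero, cobTrace_single]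
      obtain ⟨c, hc, h⟩ := x.hasInnerEnd_closure.2 hx
      rw [Evaluation.evalDiagram, Multiset.prod_eq_zero, mul_zero]
      refine Multiset.mem_map.2 ⟨c, hc, ?_⟩
      rcases c with ⟨a, w, b⟩ | c
      · rfl
      · exact h.elim
    · obtain ⟨y, rfl⟩ := exists_allowInner_eq hx
      rw [truncate_single_allowInner, cobTrace_single, cobTrace_single]
      exact congrArg (fun d => a * Multiset.prod d)
        (Multiset.map_congr rfl fun c _ => (evalComponent_pair_zero c).symm)

end Truncation

/-! ### The equivalence of skein categories. -/

section Comparison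

variable {k : Type u} [Field k] {S : Type v}

/-- Composition of linear combinations of cobordisms. -/
noncomputable def linComp {inner : Bool} {X Y Z : SignSeq} (f : Cobordism S inner X Y →₀ k)
    (g : Cobordism S inner Y Z →₀ k) : Cobordism S inner X Z →₀ k :=
  (show Free.of k (Cob.mk X) ⟶ Free.of k (Cob.mk Y) from f) ≫
    (show Free.of k (Cob.mk Y) ⟶ Free.of k (Cob.mk Z) from g)

theorem zero_linComp {inner : Bool} {X Y Z : SignSeq} (g : Cobordism S inner Y Z →₀ k) :
    linComp (0 : Cobordism S inner X Y →₀ k) g = 0 :=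
  Limits.zero_comp (X := Free.of k (Cob.mk X)) (Y := Free.of k (Cob.mk Y))
    (Z := Free.of k (Cob.mk Z))

theorem linComp_zero {inner : Bool} {X Y Z : SignSeq} (f : Cobordism S inner X Y →₀ k) :
    linComp f (0 : Cobordism S inner Y Z →₀ k) = 0 :=
  Limits.comp_zero (X := Free.of k (Cob.mk X)) (Y := Free.of k (Cob.mk Y))
    (Z := Free.of k (Cob.mk Z))

theorem linComp_single_single {inner : Bool} {X Y Z : SignSeq} (x : Cobordism S inner X Y)
    (y : Cobordism S inner Y Z) :
    linComp (Finsupp.single x (1 : k)) (Finsupp.single y 1) = Finsupp.single (x.comp y) 1 :=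
  (LinCob.comp_single (X := Cob.mk X) (Y := Cob.mk Y) (Z := Cob.mk Z)
    (Finsupp.single x (1 : k)) y).trans Finsupp.mapDomain_single

theorem truncate_comp {X Y Z : SignSeq} (x : Cobordism S true X Y) (y : Cobordism S true Y Z) :
    truncate (Finsupp.single (x.comp y) (1 : k)) =
      linComp (truncate (Finsupp.single x 1)) (truncate (Finsupp.single y 1)) := by
  by_cases hx : x.HasInnerEnd
  · rw [truncate_single_of_hasInnerEnd ((Cobordism.hasInnerEnd_comp x y).2 (.inl hx)),
      truncate_single_of_hasInnerEnd hx, zero_linComp]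
  · by_cases hy : y.HasInnerEnd
    · rw [truncate_single_of_hasInnerEnd ((Cobordism.hasInnerEnd_comp x y).2 (.inr hy)),
        truncate_single_of_hasInnerEnd hy, linComp_zero]
    · obtain ⟨x, rfl⟩ := Cobordism.exists_allowInner_eq hx
      obtain ⟨y, rfl⟩ := Cobordism.exists_allowInner_eq hy
      rw [truncate_single_allowInner, truncate_single_allowInner, linComp_single_single]
      -- Allowing inner endpoints commutes with composition definitionally, since both composites
      -- glue the same diagrams.
      exact truncate_single_allowInner (x.comp y) 1

/-- The linear functor that discards the cobordisms with inner endpoints. -/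
noncomputable def truncateFunctor (k : Type u) [Field k] (S : Type v) :
    LinCob k S true ⥤ LinCob k S false where
  obj X := Free.of k (Cob.mk (Cob.obj X))
  map {X Y} f := truncate (k := k) (X := Cob.obj X) (Y := Cob.obj Y) f
  map_id X := truncate_single_allowInner (Cobordism.id (Cob.obj X)) 1
  map_comp {X Y Z} f g := by
    -- Both sides are bilinear in `f` and `g`, so the two nested inductions reduce to basis
    -- elements, where `truncate_comp` applies.
    induction f using LinCob.hom_induction with
    | zero =>
      rw [Limits.zero_comp]
      exact (map_zero _).trans ((congrArg (· ≫ _) (map_zero _)).trans Limits.zero_comp).symm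
    | add f f' hf hf' =>
      rw [Preadditive.add_comp]
      exact (map_add _ _ _).trans ((congrArg₂ _ hf hf').trans
        ((congrArg (· ≫ _) (map_add _ _ _)).trans (Preadditive.add_comp _ _ _ _ _ _)).symm)
    | smul a x =>
      rw [Linear.smul_comp]
      refine (map_smul _ _ _).trans (Eq.trans ?_
        ((congrArg (· ≫ _) (map_smul _ _ _)).trans (Linear.smul_comp _ _ _ _ _ _)).symm)
      congr 1
      induction g using LinCob.hom_induction with
      | zero =>
        rw [Limits.comp_zero]
        exact (map_zero _).trans ((congrArg (_ ≫ ·) (map_zero _)).trans Limits.comp_zero).symm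
      | add f f' hf hf' =>
        rw [Preadditive.comp_add]
        exact (map_add _ _ _).trans ((congrArg₂ _ hf hf').trans
          ((congrArg (_ ≫ ·) (map_add _ _ _)).trans (Preadditive.comp_add _ _ _ _ _ _)).symm)
      | smul b y =>
        rw [Linear.comp_smul]
        refine (map_smul _ _ _).trans (Eq.trans ?_
          ((congrArg (_ ≫ ·) (map_smul _ _ _)).trans (Linear.comp_smul _ _ _ _ _ _)).symm)
        congr 1
        refine Eq.trans (congrArg truncate ?_) (truncate_comp x y)
        exact linComp_single_single x y

instance : (truncateFunctor k S).Additive where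
  map_add := map_add truncate _ _

instance : (truncateFunctor k S).Linear k where
  map_smul f r := map_smul truncate r f

instance : (truncateFunctor k S).Full where
  map_surjective f := ⟨extend f, truncate_extend f⟩

variable (αc : SymmetricSeries k S)

/-- This lets truncation descend to the skein categories. -/
theorem truncate_mem_skeinIdeal {X Y : LinCob k S true} {f : X ⟶ Y}
    (hf : f ∈ (skeinIdeal (.pair 0 αc)).carrier X Y) :
    (truncateFunctor k S).map f ∈ (skeinIdeal (.circles αc)).carrier _ _ := by
  induction hf using Submodule.span_induction with
  | mem f hf =>
    rcases SkeinRelation.truncate hf with h | h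
    · exact Eq.mpr (congrArg (· ∈ _) h) (zero_mem _)
    · exact Submodule.subset_span h
  | zero => rw [Functor.map_zero]; exact zero_mem _
  | add f g _ _ hf hg => rw [Functor.map_add]; exact add_mem hf hg
  | smul a f _ hf => rw [Functor.map_smul]; exact Submodule.smul_mem _ _ hf

theorem extend_mem_skeinIdeal {X Y : SignSeq} {f : Cobordism S false X Y →₀ k}
    (hf : f ∈ Submodule.span k {g | SkeinRelation (.circles αc) g}) :
    extend f ∈ Submodule.span k {g | SkeinRelation (.pair 0 αc) g} := by
  induction hf using Submodule.span_induction with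
  | mem f hf => exact Submodule.subset_span hf.extend
  | zero => rw [map_zero]; exact zero_mem _
  | add f g _ _ hf hg => rw [map_add]; exact add_mem hf hg
  | smul a f _ hf => rw [map_smul]; exact Submodule.smul_mem _ _ hf

/-- The converse of `truncate_mem_skeinIdeal`, and the source of faithfulness: `f` is the sum of its
discarded part, which is always in the ideal, and of `extend (truncate f)`, which is in it because
`extend` preserves relations. -/
theorem mem_skeinIdeal_of_truncate {X Y : SignSeq} {f : Cobordism S true X Y →₀ k}
    (hf : truncate f ∈ Submodule.span k {g | SkeinRelation (.circles αc) g}) :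
    f ∈ Submodule.span k {g | SkeinRelation (.pair 0 αc) g} := by
  rw [← sub_add_cancel f (extend (truncate f))]
  exact add_mem (sub_extend_truncate_mem f) (extend_mem_skeinIdeal αc hf)

/-- The functor between skein categories that discards the cobordisms with inner endpoints. -/
noncomputable def skeinComparison : Skein (.pair 0 αc) ⥤ Skein (.circles αc) :=
  CategoryTheory.Quotient.lift _ (truncateFunctor k S ⋙ (skeinIdeal (.circles αc)).proj) (by
    intro X Y f g hfg
    refine (Quotient.functor_map_eq_iff _ _ _).2 ?_
    show (truncateFunctor k S).map f - (truncateFunctor k S).map g ∈ _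
    rw [← Functor.map_sub]
    exact truncate_mem_skeinIdeal αc hfg)

instance : (skeinComparison αc).Full where
  map_surjective := by
    rintro ⟨X⟩ ⟨Y⟩ ⟨f⟩
    obtain ⟨f, rfl⟩ := (truncateFunctor k S).map_surjective (X := X) (Y := Y) f
    exact ⟨(skeinIdeal (.pair 0 αc)).proj.map f, rfl⟩

instance : (skeinComparison αc).Faithful where
  map_injective := by
    rintro ⟨X⟩ ⟨Y⟩ ⟨f⟩ ⟨g⟩ hfg
    have hfg : (skeinIdeal (.circles αc)).proj.map ((truncateFunctor k S).map f) =
      (skeinIdeal (.circles αc)).proj.map ((truncateFunctor k S).map g) := hfg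
    refine (Quotient.functor_map_eq_iff (skeinIdeal (.pair 0 αc)).rel f g).2 ?_
    have h := (Quotient.functor_map_eq_iff (skeinIdeal (.circles αc)).rel _ _).1 hfg
    change (truncateFunctor k S).map f - (truncateFunctor k S).map g ∈ _ at h
    rw [← Functor.map_sub] at h
    exact mem_skeinIdeal_of_truncate αc h

/-- Both categories have the sign sequences as objects, and the functor does not change the
sequence. -/
instance : (skeinComparison αc).EssSurj where
  mem_essImage := fun ⟨Y⟩ =>
    ⟨(skeinIdeal (.pair 0 αc)).proj.obj (Free.of k (Cob.mk (Cob.obj Y))), ⟨Iso.refl _⟩⟩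

instance : (skeinComparison αc).IsEquivalence where

instance : (skeinComparison αc).Additive where
  map_add := by
    rintro ⟨X⟩ ⟨Y⟩ ⟨f⟩ ⟨g⟩
    exact congrArg (skeinIdeal (.circles αc)).proj.map
      ((truncateFunctor k S).map_add (f := f) (g := g))

instance : (skeinComparison αc).Linear k where
  map_smul := by
    rintro ⟨X⟩ ⟨Y⟩ ⟨f⟩ r
    exact congrArg (skeinIdeal (.circles αc)).proj.map ((truncateFunctor k S).map_smul r f)

/-- The trace of a class is computed on a representative. This is the one hypothesis that the
passage to the gligible quotients requires beyond the equivalence itself. -/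
theorem skeinTrace_skeinComparison (X : Skein (.pair 0 αc)) (f : X ⟶ X) :
    (skeinTrace (.circles αc)).tr _ ((skeinComparison αc).map f) =
      (skeinTrace (.pair 0 αc)).tr X f := by
  obtain ⟨f⟩ := f
  exact cobTrace_truncate (αc := αc) f

/-- On cobordisms without inner endpoints the comparison of skein categories is the canonical
functor. -/
noncomputable def inclSkeinComparisonIso :
    Cob.incl S ⋙ toSkein (.pair 0 αc) ⋙ skeinComparison αc ≅ toSkein (.circles αc) :=
  NatIso.ofComponents (fun _ => Iso.refl _) (fun {X Y} x => by
    refine (Category.comp_id _).trans (Eq.trans ?_ (Category.id_comp _).symm)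
    exact congrArg (skeinIdeal (.circles αc)).proj.map
      (truncate_single_allowInner (k := k) (X := X.obj) (Y := Y.obj) x 1))

end Comparison

end DecCob

theorem mainTheorem5 {k : Type*} [Field k] {S : Type*} (αc : DecCob.SymmetricSeries k S) :
    ∃ (ES : DecCob.Skein (.pair 0 αc) ≌ DecCob.Skein (.circles αc))
      (EG : DecCob.Gligible (.pair 0 αc) ≌ DecCob.Gligible (.circles αc))
      (ED : DecCob.Deligne (.pair 0 αc) ≌ DecCob.Deligne (.circles αc))
      (EU : DecCob.GligibleDeligne (.pair 0 αc) ≌ DecCob.GligibleDeligne (.circles αc)),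
      ((∃ _ : ES.functor.Additive, ES.functor.Linear k) ∧
        (∃ _ : EG.functor.Additive, EG.functor.Linear k) ∧
        (∃ _ : ED.functor.Additive, ED.functor.Linear k) ∧
        (∃ _ : EU.functor.Additive, EU.functor.Linear k)) ∧
      Nonempty (DecCob.Cob.incl S ⋙ DecCob.toSkein (.pair 0 αc) ⋙ ES.functor ≅
        DecCob.toSkein (.circles αc)) ∧
      ∃ (a : ES.functor ⋙ DecCob.skeinToGligible (.circles αc) ≅
            DecCob.skeinToGligible (.pair 0 αc) ⋙ EG.functor)
        (b : ES.functor ⋙ DecCob.skeinToDeligne (.circles αc) ≅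
            DecCob.skeinToDeligne (.pair 0 αc) ⋙ ED.functor)
        (c : EG.functor ⋙ DecCob.gligibleToGligibleDeligne (.circles αc) ≅
            DecCob.gligibleToGligibleDeligne (.pair 0 αc) ⋙ EU.functor)
        (d : ED.functor ⋙ DecCob.deligneToGligibleDeligne (.circles αc) ≅
            DecCob.deligneToGligibleDeligne (.pair 0 αc) ⋙ EU.functor),
        ∀ X : DecCob.Skein (.pair 0 αc),
          (DecCob.gligibleToGligibleDeligne (.circles αc)).map (a.hom.app X) ≫
              c.hom.app ((DecCob.skeinToGligible (.pair 0 αc)).obj X) =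
            (DecCob.deligneToGligibleDeligne (.circles αc)).map (b.hom.app X) ≫
              d.hom.app ((DecCob.skeinToDeligne (.pair 0 αc)).obj X) := by
  let F := DecCob.skeinComparison αc
  have hF := DecCob.skeinTrace_skeinComparison αc
  -- Trace preservation for the extension to additive Karoubi closures is what allows it to descend
  -- to the gligible-Deligne categories.
  have hK := DecCob.TraceForm.addKar_map F hF
  let b := DecCob.toAddKarIso F
  refine ⟨F.asEquivalence, (DecCob.TraceForm.mapGligible F hF).asEquivalence,
    (DecCob.mapAddKar F).asEquivalence,
    (DecCob.TraceForm.mapGligible (DecCob.mapAddKar F) hK).asEquivalence,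
    ⟨⟨inferInstanceAs F.Additive, inferInstanceAs (F.Linear k)⟩,
      ⟨inferInstanceAs (DecCob.TraceForm.mapGligible F hF).Additive,
        inferInstanceAs ((DecCob.TraceForm.mapGligible F hF).Linear k)⟩,
      ⟨inferInstanceAs (DecCob.mapAddKar F).Additive,
        inferInstanceAs ((DecCob.mapAddKar F).Linear k)⟩,
      ⟨inferInstanceAs (DecCob.TraceForm.mapGligible (DecCob.mapAddKar F) hK).Additive,
        inferInstanceAs ((DecCob.TraceForm.mapGligible (DecCob.mapAddKar F) hK).Linear k)⟩⟩,
    -- The two squares along quotient functors commute strictly, since the functors on quotients are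
    -- lifts, so their isomorphisms are identities.
    ⟨DecCob.inclSkeinComparisonIso αc⟩, Iso.refl _, b,
    DecCob.gligibleToAddKarIso F hF hK, Iso.refl _, fun X => ?_⟩
  -- With identities for two of the squares, the equation says that the third isomorphism at the
  -- class of `X` is the quotient image of `b` at `X`, which holds by its construction.
  refine Eq.trans ?_ (Category.comp_id _).symm
  exact (congrArg (· ≫ _) (CategoryTheory.Functor.map_id _ _)).trans (Category.id_comp _)
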